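/- Let $n\ge 2$, $k=n-1$, and read indices modulo $n$ (so $a_0=a_n$). Let $R(T)=\mathbb{Z}[e^{\pm a_1},\dots,e^{\pm a_n}]/(e^{a_1+\cdots+a_n}-1)$, let $R(T)^\Delta$ be its localization at the multiplicative set generated by the elements $1-e^{a_i-a_j}$ $(i\neq j)$, and put $b_i=1-e^{-a_i}$ and $$\Omega(b_i|y)=\prod_{j\ge 1}\frac{1}{1-b_iy_j}\in R(T)^\Delta[[y_1,y_2,\dots]].$$ For $1\le i\le n-1$ let $s_i$ act on power series by exchanging $a_i$ and $a_{i+1}$ in the coefficients, and let $s_0(f)=\frac{\Omega(b_1|y)}{\Omega(b_n|y)}s_\theta(f)$, where $s_\theta$ exchanges $a_1$ and $a_n$. Let $D_i=1+(1-e^{\alpha_i})^{-1}(s_i-1)$ with $\alpha_i=a_i-a_{i+1}$ for $0\le i\le n-1$ (so $\alpha_0=a_n-a_1$). For $w$ in the affine Weyl group of type $A^{(1)}_{n-1}$ put $D_w=D_{i_1}\cdots D_{i_r}$ for a reduced expression $w=s_{i_1}\cdots s_{i_r}$. The box in row $i$ and column $j$ of a partition $\lambda$ has residue $\mathrm{res}(i,j)=j-i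 \bmod n$. For a partition $\lambda$ with $\lambda_1\le k$ let $x_\lambda$ be the product of the $s_{\mathrm{res}(i,j)}$ over the boxes of $\lambda$, taken from the bottom row to the top row and from right to left in each row (the affine Grassmannian element corresponding to $\lambda$). The closed $K$-theoretic double $k$-Schur function is $\tilde g^{(k)}_\lambda(y|b)=D_{x_\lambda}(1)$. Define $z_{ij}\in R(T)^\Delta[[y]]$ for $i\le j<i+n$ by $z_{ii}=\Omega(b_i|y)$ and $(b_i-b_j)z_{ij}=z_{i,j-1}-z_{i+1,j}$ for $i<j$, and put $z_{ij}=0$ for $i>j$. (For $1\le i\le j\le n$ these are the entries of an upper triangular matrix commuting with the matrix that has $e^{-a_1},\dots,e^{-a_n}$ on the diagonal, $-1$ on the superdiagonal and $0$ elsewhere.) Let $\lambda$ be a $k$-small partition, i.e. $\lambda_1+\ell(\lambda)\le n$. Let $\lambda'$ be its conjugate, $l=n-\lambda_1'+1$ and $r=\lambda_1$. Put $f_0^{\langle 0,s\rangle;\lambda}=1$, and for a box $(m,s)$ of $\lambda$ let $$f_m^{\langle m,s\rangle;\lambda}=h_m\bigl(e^{-a_{\mathrm{res}(t,s)}} : m\le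 t\le \lambda'_s\bigr),$$ where $h_m$ is the complete symmetric polynomial of degree $m$. Let $M_\lambda$ be the square matrix of size $\lambda'_1+\lambda_1$ whose columns are labelled $l,l+1,\dots,n+r$ and whose rows are as follows: the first $\lambda_1'$ rows are labelled $i=l,\dots,n$, and row $i$ has the entry $z_{ij}$ in column $j$; for $1\le s\le r$, the $s$-th of the last $r$ rows has the entry $(-1)^m f_m^{\langle m,s\rangle;\lambda}$ in column $n+s-m$ for $0\le m\le\lambda'_s$, and $0$ in all other columns. Put $\xi_\lambda(y)=\prod_{i=1}^{\lambda'_1}\Omega(b_{\mathrm{res}(i,1)}|y)$, which is invertible. Then $$\tilde g^{(k)}_\lambda(y|b)=\frac{\det(M_\lambda)}{\xi_\lambda(y)}.$$ -/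

import Mathlib

noncomputable section

namespace KDoubleSchur

/-! ### The representation ring `R(T)` of the maximal torus of `SL_n`

The indices `1, …, n` are read in `ZMod n`, so that `a_0 = a_n`. -/

/-- The ideal `(e^{a_1 + ⋯ + a_n} - 1)` of `ℤ[e^{± a_1}, …, e^{± a_n}]`. -/
def slIdeal (n : ℕ) : Ideal (AddMonoidAlgebra ℤ (ZMod n → ℤ)) :=
  Ideal.span {AddMonoidAlgebra.single (fun _ => (1 : ℤ)) (1 : ℤ) - 1}

/-- `R(T) = ℤ[e^{± a_1}, …, e^{± a_n}] / (e^{a_1 + ⋯ + a_n} - 1)`. -/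
def RT (n : ℕ) : Type := AddMonoidAlgebra ℤ (ZMod n → ℤ) ⧸ slIdeal n

instance (n : ℕ) : CommRing (RT n) :=
  inferInstanceAs (CommRing (AddMonoidAlgebra ℤ (ZMod n → ℤ) ⧸ slIdeal n))

/-- The quotient map onto `R(T)`. -/
def mkRT (n : ℕ) : AddMonoidAlgebra ℤ (ZMod n → ℤ) →+* RT n := Ideal.Quotient.mk (slIdeal n)

/-- The element `e^μ` of `R(T)`, where `μ = ∑ i, μ i • a_i`. -/
def expRT (n : ℕ) (μ : ZMod n → ℤ) : RT n :=
  mkRT n (AddMonoidAlgebra.single μ (1 : ℤ))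

/-- The weight `a_i`. -/
def wt (n : ℕ) (i : ZMod n) : ZMod n → ℤ := Pi.single i 1

/-- The permutation `σ` acting on weights by `a_i ↦ a_{σ i}`. -/
def permWt (n : ℕ) (σ : Equiv.Perm (ZMod n)) : (ZMod n → ℤ) →+ (ZMod n → ℤ) where
  toFun μ := fun i => μ (σ.symm i)
  map_zero' := rfl
  map_add' _ _ := rfl

theorem permWt_wt (n : ℕ) (σ : Equiv.Perm (ZMod n)) (i : ZMod n) :
    permWt n σ (wt n i) = wt n (σ i) := by
  funext j
  simp [permWt, wt, Pi.single_apply, Equiv.symm_apply_eq]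

theorem slIdeal_le_comap (n : ℕ) (σ : Equiv.Perm (ZMod n)) :
    slIdeal n ≤ (slIdeal n).comap (AddMonoidAlgebra.mapDomainRingHom ℤ (permWt n σ)) := by
  rw [slIdeal, Ideal.span_le, Set.singleton_subset_iff]
  refine Ideal.subset_span ?_
  rw [Set.mem_singleton_iff, map_sub, map_one, AddMonoidAlgebra.mapDomainRingHom_apply,
    AddMonoidAlgebra.mapDomain_single]
  rfl

/-- The natural action of a permutation on `R(T)`: the ring homomorphism `e^{a_i} ↦ e^{a_{σ i}}`. -/
def permRT (n : ℕ) (σ : Equiv.Perm (ZMod n)) : RT n →+* RT n :=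
  Ideal.quotientMap (slIdeal n) (AddMonoidAlgebra.mapDomainRingHom ℤ (permWt n σ))
    (slIdeal_le_comap n σ)

theorem permRT_expRT (n : ℕ) (σ : Equiv.Perm (ZMod n)) (μ : ZMod n → ℤ) :
    permRT n σ (expRT n μ) = expRT n (permWt n σ μ) := by
  change Ideal.Quotient.mk (slIdeal n) (AddMonoidAlgebra.mapDomainRingHom ℤ (permWt n σ)
    (AddMonoidAlgebra.single μ (1 : ℤ))) = _
  rw [AddMonoidAlgebra.mapDomainRingHom_apply, AddMonoidAlgebra.mapDomain_single]
  rfl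

/-- The multiplicative set generated by the elements `1 - e^{a_i - a_j}` with `i ≠ j`. -/
def rootSubmonoid (n : ℕ) : Submonoid (RT n) :=
  Submonoid.closure {x | ∃ i j : ZMod n, i ≠ j ∧ x = 1 - expRT n (wt n i - wt n j)}

/-- The localization `R(T)^Δ`. -/
def RTD (n : ℕ) : Type := Localization (rootSubmonoid n)

instance (n : ℕ) : CommRing (RTD n) := inferInstanceAs (CommRing (Localization (rootSubmonoid n)))

instance (n : ℕ) : Algebra (RT n) (RTD n) :=
  inferInstanceAs (Algebra (RT n) (Localization (rootSubmonoid n)))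

instance (n : ℕ) : IsLocalization (rootSubmonoid n) (RTD n) :=
  inferInstanceAs (IsLocalization (rootSubmonoid n) (Localization (rootSubmonoid n)))

theorem rootSubmonoid_le_comap (n : ℕ) (σ : Equiv.Perm (ZMod n)) :
    rootSubmonoid n ≤ (rootSubmonoid n).comap (permRT n σ) := by
  rw [rootSubmonoid, Submonoid.closure_le]
  rintro x ⟨i, j, hij, rfl⟩
  refine Submonoid.subset_closure ⟨σ i, σ j, fun h => hij (σ.injective h), ?_⟩
  rw [map_sub, map_one, permRT_expRT, map_sub, permWt_wt, permWt_wt]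

/-- The action of a permutation on `R(T)^Δ`. -/
def permRTD (n : ℕ) (σ : Equiv.Perm (ZMod n)) : RTD n →+* RTD n :=
  IsLocalization.map (RTD n) (permRT n σ) (rootSubmonoid_le_comap n σ)

/-- The element `e^μ` of `R(T)^Δ`. -/
def e (n : ℕ) (μ : ZMod n → ℤ) : RTD n := algebraMap (RT n) (RTD n) (expRT n μ)

/-- The equivariant parameter `b_i = 1 - e^{-a_i}`. -/
def b (n : ℕ) (i : ZMod n) : RTD n := 1 - e n (-wt n i)

theorem isUnit_root (n : ℕ) {i j : ZMod n} (h : i ≠ j) :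
    IsUnit (1 - e n (wt n i - wt n j)) := by
  have := IsLocalization.map_units (RTD n)
    (⟨_, Submonoid.subset_closure ⟨i, j, h, rfl⟩⟩ : rootSubmonoid n)
  simpa [e] using this

theorem isUnit_b_sub_b (n : ℕ) {i j : ZMod n} (h : i ≠ j) : IsUnit (b n i - b n j) := by
  have hmul : ∀ μ ν, e n μ * e n ν = e n (μ + ν) := fun μ ν => by
    rw [e, e, e, ← map_mul, expRT, expRT, expRT, ← map_mul, AddMonoidAlgebra.single_mul_single,
      one_mul]
  have h0 : e n 0 = 1 := by
    rw [e, expRT, ← AddMonoidAlgebra.one_def, map_one, map_one]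
  have h1 : IsUnit (e n (-wt n j)) :=
    IsUnit.of_mul_eq_one (e n (wt n j)) (by rw [hmul, neg_add_cancel, h0])
  have h2 : b n i - b n j = e n (-wt n j) * (1 - e n (wt n j - wt n i)) := by
    rw [mul_sub, mul_one, hmul, b, b]
    have : -wt n j + (wt n j - wt n i) = -wt n i := by abel
    rw [this]
    ring
  rw [h2]
  exact h1.mul (isUnit_root n h.symm)

/-! ### Formal power series in `y = (y_1, y_2, …)` and the Demazure operators -/

/-- Formal power series in countably many variables `y` with coefficients in `R(T)^Δ`; it contains
the ring of symmetric formal power series with coefficients in `R(T)`. -/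
abbrev PS (n : ℕ) : Type := MvPowerSeries ℕ (RTD n)

/-- The power series `∏_j 1 / (1 - c y_j)`: expanding the geometric series, the coefficient of the
monomial `y^m` is `c ^ |m|`. -/
def omegaSeries (n : ℕ) (c : RTD n) : PS n := fun m => c ^ m.degree

theorem isUnit_omegaSeries (n : ℕ) (c : RTD n) : IsUnit (omegaSeries n c) := by
  rw [MvPowerSeries.isUnit_iff_constantCoeff]
  have : MvPowerSeries.constantCoeff (omegaSeries n c) = 1 := by
    rw [← MvPowerSeries.coeff_zero_eq_constantCoeff_apply]
    change c ^ (0 : ℕ →₀ ℕ).degree = 1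
    simp
  rw [this]
  exact isUnit_one

/-- `Ω(b_i | y) = ∏_j 1 / (1 - b_i y_j)`, as a unit of the ring of power series. -/
def Omega (n : ℕ) (i : ZMod n) : (PS n)ˣ := (isUnit_omegaSeries n (b n i)).unit

/-- The permutation `σ` acting on the coefficients. -/
def permPS (n : ℕ) (σ : Equiv.Perm (ZMod n)) : PS n →+* PS n := MvPowerSeries.map (permRTD n σ)

/-- The action of the simple reflection `s_i` on power series. For `i ≠ 0` it exchanges `a_i` and
`a_{i+1}`; for `i = 0` it is `s_0 f = Ω(b_1|y) / Ω(b_n|y) · s_θ f`, where `s_θ` exchanges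
`a_1` and `a_n = a_0`. -/
def reflPS (n : ℕ) (i : ZMod n) (f : PS n) : PS n :=
  if i = 0 then
    ((Omega n 1 * (Omega n 0)⁻¹ : (PS n)ˣ) : PS n) * permPS n (Equiv.swap 1 0) f
  else permPS n (Equiv.swap i (i + 1)) f

/-- The Demazure operator `D_i = 1 + (1 - e^{α_i})⁻¹ (s_i - 1)`. Here `α_i = a_i - a_{i+1}`, which
for `i = 0` reads `α_0 = a_n - a_1 = -θ`. -/
def D (n : ℕ) (i : ZMod n) (f : PS n) : PS n :=
  f + MvPowerSeries.C (Ring.inverse (1 - e n (wt n i - wt n (i + 1)))) * (reflPS n i f - f)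

/-! ### The affine Weyl group and the closed `K`-theoretic double `k`-Schur functions -/

/-- The Coxeter matrix of type `A_{n-1}^{(1)}` on the nodes `ℤ / n` (the entry `0` means `∞`). -/
def affineMatrix (n : ℕ) : CoxeterMatrix (ZMod n) where
  M := Matrix.of fun i j =>
    if i = j then 1 else if n = 2 then 0 else if j = i + 1 ∨ i = j + 1 then 3 else 2
  isSymm := by
    ext i j
    simp only [Matrix.transpose_apply, Matrix.of_apply, eq_comm (a := j) (b := i),
      or_comm (a := i = j + 1) (b := j = i + 1)]
  diagonal i := by simp
  off_diagonal i j h := by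
    simp only [Matrix.of_apply, h, if_false]
    split_ifs <;> decide

/-- The affine Weyl group, with its standard generators `s_0, …, s_{n-1}`. -/
abbrev AffineWeyl (n : ℕ) : Type := (affineMatrix n).Group

/-- The affine Weyl group as a Coxeter system. -/
def affineSystem (n : ℕ) : CoxeterSystem (affineMatrix n) (AffineWeyl n) :=
  (affineMatrix n).toCoxeterSystem

/-- A reduced word of `w`. -/
def reducedWord (n : ℕ) (w : AffineWeyl n) : List (ZMod n) :=
  ((affineSystem n).exists_isReduced w).choose

/-- `D_w = D_{i_1} ∘ ⋯ ∘ D_{i_l}` for a reduced expression `w = s_{i_1} ⋯ s_{i_l}`. -/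
def DW (n : ℕ) (w : AffineWeyl n) (f : PS n) : PS n := (reducedWord n w).foldr (D n) f

/-- The closed `K`-theoretic double `k`-Schur function `g̃_w^{(k)}(y|b) = D_w(1)`, `k = n - 1`. -/
def gTildeW (n : ℕ) (w : AffineWeyl n) : PS n := DW n w 1

/-- The `n`-residues `j - i` of the boxes `(i, j)` of `lam`, read along the rows from right to
left, the bottom row first. -/
def residueWord (n : ℕ) (lam : YoungDiagram) : List (ZMod n) :=
  ((List.range (lam.colLen 0)).flatMap fun i : ℕ =>
    (List.range (lam.rowLen i)).map fun j : ℕ => (j : ZMod n) - (i : ZMod n)).reverse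

/-- The affine Grassmannian element attached to a `k`-bounded partition `lam`: the product of the
simple reflections along the residue word, `⋯ (s_{λ_2 - 2} ⋯ s_0 s_{-1}) (s_{λ_1 - 1} ⋯ s_1 s_0)`.
-/
def affineGrassmannian (n : ℕ) (lam : YoungDiagram) : AffineWeyl n :=
  (affineSystem n).wordProd (residueWord n lam)

/-- `g̃_λ^{(k)}(y|b)` for a `k`-bounded partition. -/
def gTilde (n : ℕ) (lam : YoungDiagram) : PS n := gTildeW n (affineGrassmannian n lam)

/-- `lam` is `k`-small, `k = n - 1`: `λ_1 + ℓ(λ) ≤ n`. -/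
def IsKSmall (n : ℕ) (lam : YoungDiagram) : Prop := lam.rowLen 0 + lam.colLen 0 ≤ n

/-! ### The determinant -/

/-- The function `z_{i,i+d}` of the centralizer family, as a power series:
`z_{ii} = Ω(b_i|y)` and `(b_i - b_j) z_{ij} = z_{i,j-1} - z_{i+1,j}` for `j = i + d`.
It is used for `d < n` only, where `b_i - b_j` is invertible. -/
def zDiff (n : ℕ) : ℕ → ZMod n → PS n
  | 0, i => (Omega n i : PS n)
  | d + 1, i =>
      MvPowerSeries.C (Ring.inverse (b n i - b n (i + ((d + 1 : ℕ) : ZMod n)))) *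
        (zDiff n d i - zDiff n d (i + 1))

/-- The entry `z_{ij}` for integers `i, j`; it vanishes below the diagonal. -/
def z (n i j : ℕ) : PS n := if i ≤ j then zDiff n (j - i) (i : ZMod n) else 0

/-- The equations of the centralizer `[A, Z] = 0`. -/
theorem z_centralizer (n i j : ℕ) (h : i < j) (hn : j < i + n) :
    MvPowerSeries.C (b n (i : ZMod n) - b n (j : ZMod n)) * z n i j =
      z n i (j - 1) - z n (i + 1) j := by
  obtain ⟨d, rfl⟩ : ∃ d, j = i + (d + 1) := ⟨j - i - 1, by omega⟩
  have hne : (i : ZMod n) ≠ ((i + (d + 1) : ℕ) : ZMod n) := by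
    intro hh
    rw [ZMod.natCast_eq_natCast_iff, Nat.modEq_iff_dvd' (by omega)] at hh
    have := Nat.le_of_dvd (by omega) hh
    omega
  have e1 : i + (d + 1) - i = d + 1 := by omega
  have e2 : i + (d + 1) - 1 - i = d := by omega
  have e3 : i + (d + 1) - (i + 1) = d := by omega
  rw [z, z, z, if_pos (by omega), if_pos (by omega), if_pos (by omega), e1, e2, e3, zDiff,
    ← mul_assoc, ← map_mul, ← Nat.cast_add, Ring.mul_inverse_cancel _ (isUnit_b_sub_b n hne),
    map_one, one_mul, Nat.cast_add, Nat.cast_one]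

/-- The residues of the boxes `(t, j)`, `m ≤ t ≤ λ'_j`, of the `j`-th column of `lam`
(rows and columns are numbered from `1`). -/
def columnResidues (n : ℕ) (lam : YoungDiagram) (m j : ℕ) : Finset (ZMod n) :=
  (Finset.Icc m (lam.colLen (j - 1))).image fun t : ℕ => (j : ZMod n) - (t : ZMod n)

/-- `f_m^{⟨m,j⟩;λ} = h_m(e^{-a_r} : r the residue of a box (t, j), m ≤ t ≤ λ'_j)`.
It is `1` for `m = 0` and `0` for `m > λ'_j`. -/
def fCoef (n : ℕ) (lam : YoungDiagram) (m j : ℕ) : RTD n :=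
  MvPolynomial.aeval (fun r : {r // r ∈ columnResidues n lam m j} => e n (-wt n r.1))
    (MvPolynomial.hsymm {r // r ∈ columnResidues n lam m j} ℤ m)

/-- The square matrix `M_λ` of size `ℓ(λ) + λ_1`. With `l = n - ℓ(λ) + 1`, columns carry the labels
`l, …, n + λ_1`. The first `ℓ(λ)` rows carry the labels `l, …, n` and hold the entries `z_{ij}`.
The `s`-th of the last `λ_1` rows has the entry `(-1)^m f_m^{⟨m,s⟩;λ}` in the column labelled
`n + s - m` for `0 ≤ m ≤ λ'_s`, and `0` elsewhere. Rows `p` and columns `q` of the Lean matrix are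
counted from `0`, so that `s = p - ℓ(λ) + 1` and `m = p - q`. -/
def M (n : ℕ) (lam : YoungDiagram) :
    Matrix (Fin (lam.colLen 0 + lam.rowLen 0)) (Fin (lam.colLen 0 + lam.rowLen 0)) (PS n) :=
  Matrix.of fun p q =>
    if (p : ℕ) < lam.colLen 0 then
      z n (n - lam.colLen 0 + 1 + p) (n - lam.colLen 0 + 1 + q)
    else if (q : ℕ) ≤ p then
      MvPowerSeries.C ((-1) ^ ((p : ℕ) - q) * fCoef n lam (p - q) (p - lam.colLen 0 + 1))
    else 0

/-- `ξ_λ(y) = ∏_{1 ≤ i ≤ λ'_1} Ω(b_{res(i,1)}|y)`, with `res(i,1) = 1 - i`. -/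
def xi (n : ℕ) (lam : YoungDiagram) : (PS n)ˣ :=
  ∏ i ∈ Finset.Icc 1 (lam.colLen 0), Omega n (1 - (i : ZMod n))

end KDoubleSchur

end

noncomputable section

namespace KDoubleSchur

open Finset

/-! ### Complete symmetric polynomials and Newton interpolation -/

section Interpolation

variable {A : Type*} [CommRing A]

/-! The proof builds the partition one corner at a time. Adding a corner of residue `i` corresponds
to multiplying `x_λ` on the left by `s_i`, so it must be shown that `D_i` carries `det M / ξ` of the
smaller diagram to that of the larger one.

To see the action of `D_i`, read the rows of `M_λ` as coordinates in the Newton basis whose nodes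
are the `b_r`, and evaluate at these same nodes. A row `z_{i,•}` becomes `Ω(v)` times a Newton
polynomial, since divided differences are Newton coefficients. A row of coefficients `f_m` attached
to a column of length `c` becomes `(v - 1)^c` times a Newton polynomial of degree `p - c`. Thus `det
M` is a quotient of two determinants of values (`coordMatrix_mul`). A simple reflection exchanges
two adjacent nodes. This affects only the Newton polynomial of one degree; an upper row of that
degree is repaired by a row operation, and the only lower row of that degree belongs to the column
receiving the new box. The identity `(1 - u)(v - x_j) + u(v - x_{j+1}) = v - 1`, where `u` is the
coefficient of the Demazure operator, turns `(v - 1)^c` into `(v - 1)^(c+1)` in that row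
(`divided_difference_det`). The factor `ξ` absorbs the twist in `s_0` (`reflPS_mul_inv_xiOf`).

Since `D_w` is computed from an unspecified reduced word, this step has to apply to every reduced
word of `x_λ`; braid relations for the `D_i` are not used. The affine Weyl group acts on the
integers, and an energy of the abacus of `λ` grows by at most one per letter while its value at
`x_λ` is the number of boxes. Hence the first letter of a word of length at most `|λ|` lowers the
energy, which forces it to be the residue of a corner (`exists_isCorner_of_energy_lt`). Removing
that corner gives the induction in `foldr_D_eq_detQuotOf`. -/

/-- Multisets of size `m + 1` are split according to whether they contain `none`. -/
theorem aeval_hsymm_option {α : Type*} [Fintype α] [DecidableEq α] (g : Option α → A) (m : ℕ) :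
    MvPolynomial.aeval g (MvPolynomial.hsymm (Option α) ℤ (m + 1)) =
      g none * MvPolynomial.aeval g (MvPolynomial.hsymm (Option α) ℤ m) +
        MvPolynomial.aeval (fun a => g (some a)) (MvPolynomial.hsymm α ℤ (m + 1)) := by
  have key : ∀ (β : Type _) [Fintype β] [DecidableEq β] (k : ℕ) (u : β → A),
      MvPolynomial.aeval u (MvPolynomial.hsymm β ℤ k) =
        ∑ s : Sym β k, (s.1.map u).prod := by
    intro β _ _ k u
    simp only [MvPolynomial.hsymm, map_sum, map_multiset_prod, Multiset.map_map,
      Function.comp_def, MvPolynomial.aeval_X]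
  rw [key, key, key α, ← (symOptionSuccEquiv (α := α) (n := m)).symm.sum_comp,
    Fintype.sum_sum_type, mul_sum]
  congr 1
  · refine sum_congr rfl fun s _ => ?_
    change (Multiset.map g (none ::ₘ s.1)).prod = _
    rw [Multiset.map_cons, Multiset.prod_cons]
  · refine sum_congr rfl fun s _ => ?_
    change (Multiset.map g (Multiset.map some s.1)).prod = _
    rw [Multiset.map_map]
    rfl

/-- The complete symmetric polynomial of degree `m` in the values of `f` on `S`. -/
def hsymmOn {ι : Type*} [DecidableEq ι] (S : Finset ι) (f : ι → A) (m : ℕ) : A :=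
  MvPolynomial.aeval (fun r : {r // r ∈ S} => f r.1) (MvPolynomial.hsymm {r // r ∈ S} ℤ m)

theorem hsymmOn_zero {ι : Type*} [DecidableEq ι] (S : Finset ι) (f : ι → A) : hsymmOn S f 0 = 1 := by
  simp [hsymmOn]

theorem hsymmOn_empty {ι : Type*} [DecidableEq ι] (f : ι → A) (m : ℕ) :
    hsymmOn (∅ : Finset ι) f (m + 1) = 0 := by
  have : IsEmpty (Sym {r // r ∈ (∅ : Finset ι)} (m + 1)) := by
    refine ⟨fun s => ?_⟩
    obtain ⟨a, _⟩ := Multiset.card_pos_iff_exists_mem.1 (by rw [s.2]; omega : 0 < s.1.card)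
    exact absurd a.2 (notMem_empty _)
  rw [hsymmOn, MvPolynomial.hsymm]
  simp

theorem hsymmOn_insert {ι : Type*} [DecidableEq ι] {S : Finset ι} {a : ι} (ha : a ∉ S)
    (f : ι → A) (m : ℕ) :
    hsymmOn (insert a S) f (m + 1) =
      f a * hsymmOn (insert a S) f m + hsymmOn S f (m + 1) := by
  have key : ∀ k, hsymmOn (insert a S) f k =
      MvPolynomial.aeval (fun o : Option {r // r ∈ S} => o.elim (f a) fun r => f r.1)
        (MvPolynomial.hsymm (Option {r // r ∈ S}) ℤ k) := by
    intro k
    rw [hsymmOn, ← MvPolynomial.rename_hsymm _ ℤ k (Finset.subtypeInsertEquivOption ha).symm,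
      MvPolynomial.aeval_rename]
    congr 2
    funext o
    cases o <;> rfl
  rw [key, key, aeval_hsymm_option]
  rfl

/-- The complete symmetric polynomial of degree `d` in `y 0, …, y (k - 1)`. -/
def hcomp (y : ℕ → A) : ℕ → ℕ → A
  | 0, _ => 1
  | _ + 1, 0 => 0
  | d + 1, k + 1 => y k * hcomp y d (k + 1) + hcomp y (d + 1) k

/-- Both sides obey the same recursion; injectivity ensures that each new index really adds a
variable to the set. -/
theorem hsymmOn_image_range {ι : Type*} [DecidableEq ι] (f : ι → A) (g : ℕ → ι) (k : ℕ)
    (hg : Set.InjOn g (Set.Iio k)) (d : ℕ) :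
    hsymmOn ((range k).image g) f d = hcomp (fun i => f (g i)) d k := by
  induction k generalizing d with
  | zero =>
    cases d with
    | zero => rw [hsymmOn_zero, hcomp]
    | succ d => rw [range_zero, image_empty, hsymmOn_empty, hcomp]
  | succ k ihk =>
    have hk : g k ∉ (range k).image g := by
      simp only [mem_image, mem_range, not_exists, not_and]
      intro i hi h
      have := hg (Set.mem_Iio.2 (by omega)) (Set.mem_Iio.2 (by omega)) h
      omega
    have ih := ihk (hg.mono fun i hi => Set.mem_Iio.2 (by have := Set.mem_Iio.1 hi; omega))
    induction d with
    | zero => rw [hsymmOn_zero, hcomp]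
    | succ d ihd =>
      rw [range_add_one, image_insert, hsymmOn_insert hk, hcomp, ih, ← ihd, range_add_one,
        image_insert]

/-- Newton interpolation of a monomial. -/
theorem pow_eq_sum_hcomp (y : ℕ → A) (v : A) (d : ℕ) :
    v ^ d = ∑ k ∈ range (d + 1), hcomp y (d - k) (k + 1) * ∏ i ∈ range k, (v - y i) := by
  induction d with
  | zero => simp [hcomp]
  | succ d ih =>
    -- The extra factor is written `v = (v - y k) + y k` in the `k`-th term. The two resulting sums
    -- match the two terms of the recursion for `hcomp`.
    have h1 : v ^ (d + 1) = ∑ k ∈ range (d + 1), (hcomp y (d - k) (k + 1) *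
        ∏ i ∈ range (k + 1), (v - y i)) + ∑ k ∈ range (d + 1), y k * hcomp y (d - k) (k + 1) *
          ∏ i ∈ range k, (v - y i) := by
      rw [pow_succ, ih, sum_mul, ← sum_add_distrib]
      refine sum_congr rfl fun k _ => ?_
      rw [prod_range_succ]
      ring
    have h2 : ∑ k ∈ range (d + 1), (hcomp y (d - k) (k + 1) * ∏ i ∈ range (k + 1), (v - y i)) =
        ∑ k ∈ range (d + 2), hcomp y (d + 1 - k) k * ∏ i ∈ range k, (v - y i) := by
      rw [sum_range_succ' _ (d + 1)]
      simp [hcomp]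
    have h3 : ∑ k ∈ range (d + 2), hcomp y (d + 1 - k) (k + 1) * ∏ i ∈ range k, (v - y i) =
        ∑ k ∈ range (d + 1), y k * hcomp y (d - k) (k + 1) * ∏ i ∈ range k, (v - y i) +
          ∑ k ∈ range (d + 2), hcomp y (d + 1 - k) k * ∏ i ∈ range k, (v - y i) := by
      rw [sum_range_succ, sum_range_succ _ (d + 1), ← add_assoc, ← sum_add_distrib]
      congr 1
      · refine sum_congr rfl fun k hk => ?_
        have : d + 1 - k = (d - k) + 1 := by have := mem_range.1 hk; omega
        rw [this, hcomp]
        ring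
      · rw [Nat.sub_self, hcomp, hcomp]
    rw [h1, h2, h3, add_comm]

end Interpolation

/-! ### Values of Newton polynomials, and Demazure operators as row operations -/

section Evaluation

variable {A : Type*} [CommRing A]

/-- The Newton basis polynomial with nodes `x 0, …, x (q - 1)`, evaluated at `v`. -/
def newton (x : ℕ → A) (q : ℕ) (v : A) : A := ∏ j ∈ range q, (v - x j)

theorem newton_succ (x : ℕ → A) (q : ℕ) (v : A) :
    newton x (q + 1) v = newton x q v * (v - x q) := prod_range_succ _ _

theorem newton_eq_zero (x : ℕ → A) {q k : ℕ} (h : k < q) : newton x q (x k) = 0 :=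
  prod_eq_zero (mem_range.2 h) (sub_self _)

theorem newton_add (x : ℕ → A) (q k : ℕ) (v : A) :
    newton x (q + k) v = newton x q v * ∏ i ∈ range k, (v - x (q + i)) := prod_range_add _ _ _

/-- Divided differences are the coefficients of Newton interpolation. -/
theorem sum_dividedDifference_mul_newton {x f : ℕ → A} {Z : ℕ → ℕ → A} {N : ℕ}
    (hx : ∀ p q, p < q → q < N → IsUnit (x p - x q)) (hdiag : ∀ p, Z p p = f p)
    (hlow : ∀ p q, q < p → Z p q = 0)
    (hrec : ∀ p q, p < q → q < N → (x p - x q) * Z p q = Z p (q - 1) - Z (p + 1) q)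
    {k : ℕ} (hk : k < N) (p : ℕ) :
    ∑ q ∈ range N, Z p q * newton x q (x k) = f k * newton x p (x k) := by
  rcases lt_or_ge k p with hkp | hkp
  · rw [newton_eq_zero x hkp, mul_zero]
    refine sum_eq_zero fun q _ => ?_
    rcases lt_or_ge q p with h | h
    · rw [hlow p q h, zero_mul]
    · rw [newton_eq_zero x (hkp.trans_le h), mul_zero]
  · have htrunc : ∀ p, ∑ q ∈ range N, Z p q * newton x q (x k) =
        ∑ q ∈ range (k + 1), Z p q * newton x q (x k) := fun p => by
      symm
      refine sum_subset (range_subset_range.2 hk) fun q _ hq => ?_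
      rw [newton_eq_zero x (by simpa using hq), mul_zero]
    rw [htrunc]
    clear htrunc
    induction hkp using Nat.decreasingInduction with
    | self =>
      rw [sum_range_succ, hdiag, sum_eq_zero, zero_add]
      intro q hq
      rw [hlow k q (mem_range.1 hq), zero_mul]
    | of_succ p hpk ih =>
      -- Downward induction on `p` from `k`: after multiplication by `x k - x p`, the right side
      -- becomes the one for `p + 1`. On the left, `x k - x p = (x k - x q) - (x p - x q)`; the
      -- first part raises the Newton degree, and after a shift of index the recursion for `Z`
      -- applies.
      have hu : IsUnit (x k - x p) := by
        rw [← neg_sub]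
        exact (hx p k hpk hk).neg
      refine hu.mul_left_cancel ?_
      have h1 : (x k - x p) * (f k * newton x p (x k)) = f k * newton x (p + 1) (x k) := by
        rw [newton_succ]
        ring
      rw [h1, ← ih, mul_sum]
      have h2 : ∀ q ∈ range (k + 1), (x k - x p) * (Z p q * newton x q (x k)) =
          Z p q * newton x (q + 1) (x k) - (x p - x q) * Z p q * newton x q (x k) := by
        intro q _
        rw [newton_succ]
        ring
      rw [sum_congr rfl h2, sum_sub_distrib, sum_range_succ, newton_eq_zero x (Nat.lt_succ_self k),
        mul_zero, add_zero, sum_range_succ' (fun q => (x p - x q) * Z p q * newton x q (x k)),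
        sum_range_succ' (fun q => Z (p + 1) q * newton x q (x k)), hlow (p + 1) 0 (by omega),
        zero_mul, add_zero]
      have h3 : (x p - x 0) * Z p 0 * newton x 0 (x k) = 0 := by
        rcases Nat.eq_zero_or_pos p with rfl | h
        · rw [sub_self, zero_mul, zero_mul]
        · rw [hlow p 0 h, mul_zero, zero_mul]
      rw [h3, add_zero, ← sum_sub_distrib]
      refine sum_congr rfl fun q hq => ?_
      have hq' := mem_range.1 hq
      -- The recursion holds only above the diagonal. On and below it, all terms vanish.
      rcases lt_trichotomy p (q + 1) with h | h | h
      · rw [hrec p (q + 1) h (by omega), Nat.add_sub_cancel]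
        ring
      · rw [← h, sub_self, zero_mul, zero_mul, sub_zero, hlow p q (by omega),
          hlow (p + 1) p (by omega)]
      · rw [hlow p q (by omega), hlow p (q + 1) h, hlow (p + 1) (q + 1) (by omega)]
        ring

theorem hcomp_neg (y : ℕ → A) (d k : ℕ) :
    hcomp (fun i => -y i) d k = (-1) ^ d * hcomp y d k := by
  induction d generalizing k with
  | zero => simp [hcomp]
  | succ d ihd =>
    induction k with
    | zero => simp [hcomp]
    | succ k ihk =>
      rw [hcomp, hcomp, ihd, ihk]
      ring

/-- The coordinates of `(v - 1) ^ c * newton x (p - c) v` in the Newton basis. -/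
theorem sum_hcomp_mul_newton (x : ℕ → A) {F : ℕ → A} {p c N : ℕ} (hc : c ≤ p) (hp : p < N)
    (hF : ∀ m, m ≤ c → F m = hcomp (fun i => 1 - x (p - c + i)) m (c - m + 1))
    (hF0 : ∀ m, c < m → F m = 0) (v : A) :
    ∑ q ∈ range N, (if q ≤ p then (-1) ^ (p - q) * F (p - q) else 0) * newton x q v =
      (v - 1) ^ c * newton x (p - c) v := by
  have h1 : ∑ q ∈ range N, (if q ≤ p then (-1) ^ (p - q) * F (p - q) else 0) * newton x q v =
      ∑ q ∈ range (p - c + (c + 1)),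
        (if q ≤ p then (-1) ^ (p - q) * F (p - q) else 0) * newton x q v := by
    symm
    refine sum_subset (range_subset_range.2 (by omega)) fun q _ hq => ?_
    rw [mem_range] at hq
    rw [if_neg (by omega), zero_mul]
  -- `(v - 1) ^ c` is interpolated at the nodes `x (p - c + i) - 1`, so that its factors are `v - x
  -- (p - c + i)` and extend `newton x (p - c) v`. The sign `(-1) ^ (p - q)` comes from replacing
  -- these nodes by `1 - x (p - c + i)`.
  rw [h1, sum_range_add, sum_eq_zero, zero_add, pow_eq_sum_hcomp (fun i => x (p - c + i) - 1),
    sum_mul]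
  · refine sum_congr rfl fun k hk => ?_
    have hk' := mem_range.1 hk
    have e1 : p - (p - c + k) = c - k := by omega
    have e2 : c - (c - k) + 1 = k + 1 := by omega
    rw [if_pos (by omega), e1, hF _ (by omega), e2, newton_add]
    have h2 : (fun i => 1 - x (p - c + i)) = fun i => -(x (p - c + i) - 1) := by
      funext i
      ring
    rw [h2, hcomp_neg, ← mul_assoc ((-1 : A) ^ (c - k)), ← pow_add, ← two_mul, pow_mul, neg_one_sq,
      one_pow, one_mul]
    have h3 : ∀ i, v - 1 - (x (p - c + i) - 1) = v - x (p - c + i) := fun i => by ring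
    simp only [h3]
    ring
  · intro q hq
    have hq' := mem_range.1 hq
    rw [hF0 _ (by omega), mul_zero, ite_self, zero_mul]

/-- The matrix whose first `l` rows hold the values of `f` times the Newton basis polynomials, and
whose further rows hold the values of `(v - 1) ^ c * newton x (p - c) v`, at the points `x k`. -/
def evalMatrix (x f : ℕ → A) (l N : ℕ) (c : ℕ → ℕ) : Matrix (Fin N) (Fin N) A :=
  Matrix.of fun p k => if (p : ℕ) < l then f k * newton x p (x k)
    else (x k - 1) ^ c (p - l) * newton x (p - c (p - l)) (x k)

theorem isUnit_det_evalMatrix {x : ℕ → A} {N : ℕ}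
    (hx : ∀ p q, p < q → q < N → IsUnit (x p - x q)) (c : ℕ → ℕ) :
    IsUnit (evalMatrix x (fun _ => 1) N N c).det := by
  have h : (evalMatrix x (fun _ => 1) N N c).det = ∏ k : Fin N, newton x k (x k) := by
    rw [Matrix.det_of_isUpperTriangular]
    · refine prod_congr rfl fun k _ => ?_
      rw [evalMatrix, Matrix.of_apply, if_pos k.2, one_mul]
    · intro p k hkp
      have hkp' : (k : ℕ) < p := hkp
      rw [evalMatrix, Matrix.of_apply, if_pos p.2, newton_eq_zero x hkp', mul_zero]
  rw [h]
  refine IsUnit.prod_univ_iff.2 fun k => IsUnit.prod_iff.2 fun j hj => ?_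
  rw [← neg_sub]
  exact (hx j k (mem_range.1 hj) k.2).neg

/-- Only `range (j + 1)` contains exactly one of `j` and `j + 1`. -/
theorem prod_range_swap {B : Type*} [CommMonoid B] (g : ℕ → B) {q j : ℕ} (h : q ≠ j + 1) :
    ∏ k ∈ range q, g (Equiv.swap j (j + 1) k) = ∏ k ∈ range q, g k := by
  rcases lt_or_gt_of_ne h with h | h
  · refine prod_congr rfl fun k hk => ?_
    have := mem_range.1 hk
    rw [Equiv.swap_apply_of_ne_of_ne (by omega) (by omega)]
  · refine Equiv.Perm.prod_comp _ _ _ fun k hk => ?_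
    simp only [coe_range, Set.mem_Iio]
    by_contra hk'
    exact hk (Equiv.swap_apply_of_ne_of_ne (by omega) (by omega))

theorem newton_swap (x : ℕ → A) {q j : ℕ} (h : q ≠ j + 1) (v : A) :
    newton (fun k => x (Equiv.swap j (j + 1) k)) q v = newton x q v :=
  prod_range_swap (fun k => v - x k) h

theorem newton_swap_succ (x : ℕ → A) (j : ℕ) (v : A) :
    newton (fun k => x (Equiv.swap j (j + 1) k)) (j + 1) v = newton x j v * (v - x (j + 1)) := by
  rw [newton_succ, newton_swap x (by omega), Equiv.swap_apply_left]

/-- The matrix `evalMatrix x f l N c` with the nodes `x j` and `x (j + 1)` exchanged. -/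
def swapMatrix (x f : ℕ → A) (l N : ℕ) (c : ℕ → ℕ) (j : ℕ) : Matrix (Fin N) (Fin N) A :=
  Matrix.of fun p k => if (p : ℕ) < l then
      f k * newton (fun k => x (Equiv.swap j (j + 1) k)) p (x k)
    else (x k - 1) ^ c (p - l) *
      newton (fun k => x (Equiv.swap j (j + 1) k)) (p - c (p - l)) (x k)

/-- `σ` moves both the nodes and the evaluation points. Undoing the latter exchanges two columns,
whence the sign. -/
theorem det_swapMatrix (σ : A →+* A) (x f : ℕ → A) {l N j : ℕ} {c : ℕ → ℕ} (hj : j + 1 < N)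
    (hσx : ∀ k < N, σ (x k) = x (Equiv.swap j (j + 1) k))
    (hσf : ∀ k < N, σ (f k) = f (Equiv.swap j (j + 1) k)) :
    σ (evalMatrix x f l N c).det = -(swapMatrix x f l N c j).det := by
  have hσn : ∀ q ≤ N, ∀ v, σ (newton x q v) =
      newton (fun k => x (Equiv.swap j (j + 1) k)) q (σ v) := by
    intro q hq v
    rw [newton, newton, map_prod]
    refine prod_congr rfl fun k hk => ?_
    rw [map_sub, hσx k (by have := mem_range.1 hk; omega)]
  have hne : (⟨j, by omega⟩ : Fin N) ≠ ⟨j + 1, hj⟩ := by simp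
  have hval : ∀ k : Fin N, ((Equiv.swap (⟨j, by omega⟩ : Fin N) ⟨j + 1, hj⟩ k : Fin N) : ℕ) =
      Equiv.swap j (j + 1) (k : ℕ) := by
    intro k
    simp only [Equiv.swap_apply_def, Fin.ext_iff]
    split_ifs <;> rfl
  rw [RingHom.map_det]
  have h : σ.mapMatrix (evalMatrix x f l N c) = (swapMatrix x f l N c j).submatrix id
      (Equiv.swap (⟨j, by omega⟩ : Fin N) ⟨j + 1, hj⟩) := by
    ext p k
    simp only [RingHom.mapMatrix_apply, Matrix.map_apply, evalMatrix, swapMatrix,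
      Matrix.submatrix_apply, Matrix.of_apply, id, hval]
    split_ifs
    · rw [map_mul, hσn _ (by omega), hσx k k.2, hσf k k.2]
    · rw [map_mul, hσn _ (by omega), map_pow, map_sub, map_one, hσx k k.2]
  rw [h, Matrix.det_permute', Equiv.Perm.sign_swap hne]
  simp

/-- Only Newton polynomials of degree `j + 1` notice the exchange. In the upper block the change is
a multiple of row `j`, as `v - x (j + 1) = (v - x j) + (x j - x (j + 1))`; in the lower block only
row `s` has this degree. -/
theorem det_swapMatrix_eq (x f : ℕ → A) {l N j : ℕ} {c : ℕ → ℕ} (hj : j + 1 < N)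
    {s : ℕ} (hsN : l + s < N) (hs : l + s - c s = j + 1)
    (hc : ∀ s', l + s' < N → s' ≠ s → l + s' - c s' ≠ j + 1) :
    (swapMatrix x f l N c j).det = ((evalMatrix x f l N c).updateRow ⟨l + s, hsN⟩ fun k =>
      (x k - 1) ^ c s * (newton x j (x k) * (x k - x (j + 1)))).det := by
  refine Matrix.det_eq_of_forall_row_eq_smul_add_const
    (fun p : Fin N => if (p : ℕ) < l ∧ (p : ℕ) = j + 1 then x j - x (j + 1) else 0)
    ⟨j, by omega⟩ (if_neg fun h => by simp at h) fun p k => ?_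
  rcases lt_or_ge (p : ℕ) l with hp | hp
  · have hne : p ≠ ⟨l + s, hsN⟩ := fun h => by
      have := congrArg Fin.val h
      simp at this
      omega
    rw [Matrix.updateRow_ne hne, swapMatrix, evalMatrix, Matrix.of_apply, if_pos hp]
    by_cases hpj : (p : ℕ) = j + 1
    · have hne' : (⟨j, by omega⟩ : Fin N) ≠ ⟨l + s, hsN⟩ := fun h => by
        have := congrArg Fin.val h
        simp at this
        omega
      rw [Matrix.updateRow_ne hne', Matrix.of_apply, Matrix.of_apply, if_pos hp,
        if_pos ⟨hp, hpj⟩, if_pos (show j < l by omega), hpj, newton_swap_succ, newton_succ]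
      ring
    · rw [Matrix.of_apply, if_pos hp, if_neg fun h => hpj h.2, zero_mul, add_zero,
        newton_swap x hpj]
  · rw [if_neg fun h => by omega, zero_mul, add_zero]
    by_cases hps : p = ⟨l + s, hsN⟩
    · subst hps
      rw [Matrix.updateRow_self, swapMatrix, Matrix.of_apply, if_neg (by simp),
        show ((⟨l + s, hsN⟩ : Fin N) : ℕ) - l = s by simp, hs, newton_swap_succ]
    · have hne : (p : ℕ) - l ≠ s := fun h => hps (Fin.ext (by simp; omega))
      have h1 := hc (p - l) (by omega) hne
      rw [Nat.add_sub_cancel' hp] at h1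
      rw [Matrix.updateRow_ne hps, swapMatrix, evalMatrix, Matrix.of_apply, Matrix.of_apply,
        if_neg (by omega), if_neg (by omega), newton_swap x h1]

theorem det_swapMatrix_top (x f : ℕ → A) {N j : ℕ} {c : ℕ → ℕ} (hj : j + 1 < N) :
    (swapMatrix x f N N c j).det = (evalMatrix x f N N c).det := by
  refine Matrix.det_eq_of_forall_row_eq_smul_add_const
    (fun p : Fin N => if (p : ℕ) = j + 1 then x j - x (j + 1) else 0)
    ⟨j, by omega⟩ (if_neg fun h => by simp at h) fun p k => ?_
  rw [swapMatrix, evalMatrix, Matrix.of_apply, Matrix.of_apply, Matrix.of_apply, if_pos p.2,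
    if_pos p.2, if_pos (show j < N by omega)]
  by_cases hpj : (p : ℕ) = j + 1
  · rw [if_pos hpj, hpj, newton_swap_succ, newton_succ]
    ring
  · rw [if_neg hpj, zero_mul, add_zero, newton_swap x hpj]

/-- Adding a box at the bottom of a column is a divided difference. Here `G` and `G'` are the
determinants of the coordinate matrices before and after the box is added. -/
theorem divided_difference_det (σ : A →+* A) (x f : ℕ → A) {l N j : ℕ} {c : ℕ → ℕ}
    (hx : ∀ p q, p < q → q < N → IsUnit (x p - x q))
    (hσx : ∀ k < N, σ (x k) = x (Equiv.swap j (j + 1) k))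
    (hσf : ∀ k < N, σ (f k) = f (Equiv.swap j (j + 1) k))
    {s : ℕ} (hsN : l + s < N) (hs : l + s - c s = j + 1)
    (hc : ∀ s', l + s' < N → s' ≠ s → l + s' - c s' ≠ j + 1)
    {u : A} (hu : u * (x j - x (j + 1)) = x j - 1) {G G' : A}
    (hG : G * (evalMatrix x (fun _ => 1) N N c).det = (evalMatrix x f l N c).det)
    (hG' : G' * (evalMatrix x (fun _ => 1) N N c).det =
      (evalMatrix x f l N (Function.update c s (c s + 1))).det) :
    G + u * (σ G - G) = G' := by
  have hj : j + 1 < N := by omega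
  have hV : σ (evalMatrix x (fun _ => 1) N N c).det = -(evalMatrix x (fun _ => 1) N N c).det := by
    rw [det_swapMatrix σ x _ hj hσx fun _ _ => map_one σ, det_swapMatrix_top x _ hj]
  have hE : (evalMatrix x f l N c).det = ((evalMatrix x f l N c).updateRow ⟨l + s, hsN⟩ fun k =>
      (x k - 1) ^ c s * (newton x j (x k) * (x k - x j))).det := by
    congr 1
    rw [eq_comm]
    convert! Matrix.updateRow_eq_self (evalMatrix x f l N c) ⟨l + s, hsN⟩ using 2
    funext k
    rw [evalMatrix, Matrix.of_apply, if_neg (by simp),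
      show ((⟨l + s, hsN⟩ : Fin N) : ℕ) - l = s by simp, hs, newton_succ]
  have hE' : evalMatrix x f l N (Function.update c s (c s + 1)) =
      (evalMatrix x f l N c).updateRow ⟨l + s, hsN⟩ fun k =>
        (x k - 1) ^ (c s + 1) * newton x j (x k) := by
    ext p k
    by_cases hps : p = ⟨l + s, hsN⟩
    · subst hps
      rw [Matrix.updateRow_self, evalMatrix, Matrix.of_apply, if_neg (by simp),
        show ((⟨l + s, hsN⟩ : Fin N) : ℕ) - l = s by simp, Function.update_self,
        show l + s - (c s + 1) = j by omega]
    · rw [Matrix.updateRow_ne hps, evalMatrix, evalMatrix, Matrix.of_apply, Matrix.of_apply]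
      rcases lt_or_ge (p : ℕ) l with hp | hp
      · rw [if_pos hp, if_pos hp]
      · have hne : (p : ℕ) - l ≠ s := fun h => hps (Fin.ext (by simp; omega))
        rw [if_neg (by omega), if_neg (by omega), Function.update_of_ne hne]
  have hσE : (evalMatrix x (fun _ => 1) N N c).det * σ G =
      ((evalMatrix x f l N c).updateRow ⟨l + s, hsN⟩ fun k =>
        (x k - 1) ^ c s * (newton x j (x k) * (x k - x (j + 1)))).det := by
    have h := congrArg σ hG
    rw [map_mul, hV, det_swapMatrix σ x f hj hσx hσf, det_swapMatrix_eq x f hj hsN hs hc] at h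
    linear_combination -h
  -- By `hu`, `(1 - u) * (v - x j) + u * (v - x (j + 1)) = v - 1`: one linear factor of the Newton
  -- polynomial is traded for a factor `v - 1`.
  have hrow : (fun k : Fin N => (x k - 1) ^ (c s + 1) * newton x j (x k)) =
      (1 - u) • (fun k : Fin N => (x k - 1) ^ c s * (newton x j (x k) * (x k - x j))) +
        u • fun k : Fin N => (x k - 1) ^ c s * (newton x j (x k) * (x k - x (j + 1))) := by
    funext k
    simp only [Pi.add_apply, Pi.smul_apply, smul_eq_mul]
    linear_combination (-((x k - 1) ^ c s * newton x j (x k))) * hu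
  refine (isUnit_det_evalMatrix hx c).mul_right_cancel ?_
  rw [hG', hE', hrow, Matrix.det_updateRow_add, Matrix.det_updateRow_smul,
    Matrix.det_updateRow_smul, ← hE, ← hσE]
  linear_combination (1 - u) * hG

end Evaluation

/-! ### The symmetric group action -/

theorem e_mul (n : ℕ) (μ ν : ZMod n → ℤ) : e n μ * e n ν = e n (μ + ν) := by
  rw [e, e, e, ← map_mul, expRT, expRT, expRT, ← map_mul, AddMonoidAlgebra.single_mul_single,
    one_mul]

theorem permRTD_e (n : ℕ) (σ : Equiv.Perm (ZMod n)) (μ : ZMod n → ℤ) :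
    permRTD n σ (e n μ) = e n (permWt n σ μ) := by
  rw [e, permRTD, IsLocalization.map_eq, permRT_expRT, e]

theorem permRTD_b (n : ℕ) (σ : Equiv.Perm (ZMod n)) (i : ZMod n) :
    permRTD n σ (b n i) = b n (σ i) := by
  rw [b, map_sub, map_one, permRTD_e, map_neg, permWt_wt, b]

theorem permPS_C (n : ℕ) (σ : Equiv.Perm (ZMod n)) (a : RTD n) :
    permPS n σ (MvPowerSeries.C a) = MvPowerSeries.C (permRTD n σ a) :=
  MvPowerSeries.map_C _ _

theorem permPS_Omega (n : ℕ) (σ : Equiv.Perm (ZMod n)) (i : ZMod n) :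
    permPS n σ (Omega n i : PS n) = (Omega n (σ i) : PS n) := by
  ext m
  rw [permPS, MvPowerSeries.coeff_map]
  change permRTD n σ (b n i ^ m.degree) = b n (σ i) ^ m.degree
  rw [map_pow, permRTD_b]

/-- This is the hypothesis on `u` in `divided_difference_det`, and the reason why the point `1`
plays a special role. It rests on `b_i - 1 = -e^{-a_i}`. -/
theorem inverse_mul_b_sub_b (n : ℕ) {i j : ZMod n} (h : i ≠ j) :
    Ring.inverse (1 - e n (wt n i - wt n j)) * (b n i - b n j) = b n i - 1 := by
  have h1 : b n i - b n j = (1 - e n (wt n i - wt n j)) * (b n i - 1) := by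
    rw [b, b]
    have h2 : e n (-wt n j) = e n (wt n i - wt n j) * e n (-wt n i) := by
      rw [e_mul]
      congr 1
      abel
    rw [h2]
    ring
  rw [h1, ← mul_assoc, Ring.inverse_mul_cancel _ (isUnit_root n h), one_mul]

/-! ### The coordinate matrix -/

/-- The residue `1 - l + k` that labels the `k`-th column, when the matrix has `l` upper rows. -/
def node (n l k : ℕ) : ZMod n := (k : ZMod n) + 1 - l

theorem node_succ (n l k : ℕ) : node n l (k + 1) = node n l k + 1 := by
  rw [node, node]
  push_cast
  ring

theorem natCast_label {n l : ℕ} (hl : l ≤ n) (k : ℕ) :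
    ((n - l + 1 + k : ℕ) : ZMod n) = node n l k := by
  rw [node]
  push_cast [Nat.cast_sub hl, ZMod.natCast_self]
  ring

theorem node_injOn {n l p q : ℕ} (hp : p < n) (hq : q < n) (h : node n l p = node n l q) :
    p = q := by
  have h1 : (p : ZMod n) = q := by
    rw [node, node] at h
    linear_combination h
  rw [ZMod.natCast_eq_natCast_iff'] at h1
  rwa [Nat.mod_eq_of_lt hp, Nat.mod_eq_of_lt hq] at h1

theorem node_eq_zero_iff {n l k : ℕ} (hl : l ≤ n) (hk : k + 1 < n) :
    node n l k = 0 ↔ k + 1 = l := by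
  have h1 : node n l k = 0 ↔ ((k + 1 : ℕ) : ZMod n) = l := by
    rw [node, sub_eq_zero]
    push_cast
    rfl
  rw [h1]
  refine ⟨fun h => ?_, fun h => by rw [h]⟩
  rw [ZMod.natCast_eq_natCast_iff', Nat.mod_eq_of_lt hk] at h
  rcases hl.lt_or_eq with hl | rfl
  · rwa [Nat.mod_eq_of_lt hl] at h
  · rw [Nat.mod_self] at h
    omega

/-- The point `b_r` as a power series, for the residue `r` of the `k`-th column. -/
def point (n l k : ℕ) : PS n := MvPowerSeries.C (b n (node n l k))

theorem isUnit_point_sub_point {n l N : ℕ} (hN : N ≤ n) (p q : ℕ) (hpq : p < q) (hq : q < N) :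
    IsUnit (point n l p - point n l q) := by
  rw [point, point, ← map_sub]
  refine (isUnit_b_sub_b n fun h => ?_).map _
  have := node_injOn (by omega) (by omega) h
  omega

/-- The matrix `M` for arbitrary numbers `l` of upper rows and `N` of columns, and for columns of
lengths `c 0, c 1, …`. -/
def coordMatrix (n l N : ℕ) (c : ℕ → ℕ) : Matrix (Fin N) (Fin N) (PS n) :=
  Matrix.of fun p q =>
    if (p : ℕ) < l then z n (n - l + 1 + p) (n - l + 1 + q)
    else if (q : ℕ) ≤ p then
      (-1) ^ ((p : ℕ) - q) * MvPowerSeries.C (hsymmOn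
        ((Icc ((p : ℕ) - q) (c (p - l))).image fun t : ℕ =>
          (((p : ℕ) - l + 1 : ℕ) : ZMod n) - (t : ZMod n))
        (fun r => e n (-wt n r)) ((p : ℕ) - q))
    else 0

theorem M_eq_coordMatrix (n : ℕ) (lam : YoungDiagram) :
    M n lam = coordMatrix n (lam.colLen 0) (lam.colLen 0 + lam.rowLen 0) lam.colLen := by
  ext1 p q
  rw [M, coordMatrix, Matrix.of_apply, Matrix.of_apply]
  split_ifs with h1 h2
  · rfl
  · rw [map_mul, map_pow, map_neg, map_one]
    rfl
  · rfl

theorem map_hcomp {A B : Type*} [CommRing A] [CommRing B] (g : A →+* B) (y : ℕ → A) (d k : ℕ) :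
    g (hcomp y d k) = hcomp (fun i => g (y i)) d k := by
  induction d generalizing k with
  | zero => simp [hcomp]
  | succ d ihd =>
    induction k with
    | zero => simp [hcomp]
    | succ k ihk => rw [hcomp, hcomp, map_add, map_mul, ihd, ihk]

/-- Passage from Newton coordinates to values: divided differences handle the upper rows, and the
expansion of `(v - 1) ^ c` handles the lower ones. The bound `c s ≤ l` keeps the Newton degree `p -
c (p - l)` from being truncated. -/
theorem coordMatrix_mul {n l N : ℕ} (hl : l ≤ n) (hN : N ≤ n) {c : ℕ → ℕ}
    (hc : ∀ s, l + s < N → c s ≤ l) :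
    coordMatrix n l N c * evalMatrix (point n l) (fun _ => 1) N N c =
      evalMatrix (point n l) (fun k => (Omega n (node n l k) : PS n)) l N c := by
  ext1 p k
  rw [Matrix.mul_apply]
  have hV : ∀ q : Fin N, evalMatrix (point n l) (fun _ => 1) N N c q k =
      newton (point n l) q (point n l k) := fun q => by
    rw [evalMatrix, Matrix.of_apply, if_pos q.2, one_mul]
  simp only [hV]
  rw [evalMatrix, Matrix.of_apply]
  split_ifs with hp
  · have hrow : ∀ q : Fin N, coordMatrix n l N c p q = z n (n - l + 1 + p) (n - l + 1 + q) :=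
      fun q => by rw [coordMatrix, Matrix.of_apply, if_pos hp]
    simp only [hrow]
    refine (Fin.sum_univ_eq_sum_range (fun q => z n (n - l + 1 + p) (n - l + 1 + q) *
      newton (point n l) q (point n l k)) N).trans ?_
    refine sum_dividedDifference_mul_newton (x := point n l)
      (f := fun k => (Omega n (node n l k) : PS n))
      (Z := fun p q => z n (n - l + 1 + p) (n - l + 1 + q)) (isUnit_point_sub_point hN)
      (fun p => ?_) (fun p q hpq => ?_) (fun p q hpq hq => ?_) k.2 p
    · rw [z, if_pos le_rfl, Nat.sub_self, zDiff, natCast_label hl]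
    · rw [z, if_neg (by omega)]
    · have h := z_centralizer n (n - l + 1 + p) (n - l + 1 + q) (by omega) (by omega)
      rw [natCast_label hl, natCast_label hl, map_sub] at h
      rw [point, point, h]
      congr 2
      omega
  · have hc' := hc (p - l) (by omega)
    have hrow : ∀ q : Fin N, coordMatrix n l N c p q = if (q : ℕ) ≤ p then
        (-1) ^ ((p : ℕ) - q) * MvPowerSeries.C (hsymmOn
          ((Icc ((p : ℕ) - q) (c (p - l))).image fun t : ℕ =>
            (((p : ℕ) - l + 1 : ℕ) : ZMod n) - (t : ZMod n))
          (fun r => e n (-wt n r)) ((p : ℕ) - q))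
        else 0 :=
      fun q => by rw [coordMatrix, Matrix.of_apply, if_neg hp]
    simp only [hrow]
    refine (Fin.sum_univ_eq_sum_range (fun q => (if q ≤ (p : ℕ) then
        (-1) ^ ((p : ℕ) - q) * MvPowerSeries.C (hsymmOn
          ((Icc ((p : ℕ) - q) (c (p - l))).image fun t : ℕ =>
            (((p : ℕ) - l + 1 : ℕ) : ZMod n) - (t : ZMod n))
          (fun r => e n (-wt n r)) ((p : ℕ) - q))
        else 0) * newton (point n l) q (point n l k)) N).trans ?_
    refine sum_hcomp_mul_newton (point n l) (F := fun m => MvPowerSeries.C (hsymmOn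
        ((Icc m (c (p - l))).image fun t : ℕ =>
          (((p : ℕ) - l + 1 : ℕ) : ZMod n) - (t : ZMod n))
        (fun r => e n (-wt n r)) m)) (by omega) p.2 (fun m hm => ?_) (fun m hm => ?_) _
    · have h1 : (fun i => 1 - point n l (p - c (p - l) + i)) = fun i =>
          MvPowerSeries.C (σ := ℕ) (e n (-wt n (node n l (p - c (p - l) + i)))) := by
        funext i
        rw [point, b, map_sub, map_one]
        ring
      -- Reading the column upwards from its bottom box, the residues are consecutive nodes starting
      -- at index `p - c (p - l)`.
      have himg : ((Icc m (c (p - l))).image fun t : ℕ =>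
          (((p : ℕ) - l + 1 : ℕ) : ZMod n) - (t : ZMod n)) =
          (range (c (p - l) - m + 1)).image fun i => node n l (p - c (p - l) + i) := by
        have hres : ∀ t ≤ c (p - l), (((p : ℕ) - l + 1 : ℕ) : ZMod n) - (t : ZMod n) =
            node n l (p - c (p - l) + (c (p - l) - t)) := by
          intro t ht
          have e1 : (p : ℕ) - c (p - l) + (c (p - l) - t) = p - t := by omega
          rw [e1, node, Nat.cast_add, Nat.cast_sub (by omega), Nat.cast_sub (by omega),
            Nat.cast_one]
          ring
        ext r
        simp only [mem_image, mem_Icc, mem_range]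
        constructor
        · rintro ⟨t, ht, rfl⟩
          exact ⟨c (p - l) - t, by omega, (hres t ht.2).symm⟩
        · rintro ⟨i, hi, rfl⟩
          refine ⟨c (p - l) - i, by omega, ?_⟩
          rw [hres _ (by omega)]
          congr 2
          omega
      rw [h1, ← map_hcomp, himg, ← hsymmOn_image_range (fun r => e n (-wt n r))
        (fun i => node n l (p - c (p - l) + i))]
      intro i hi i' hi' h
      have h2 := Set.mem_Iio.1 hi
      have h3 := Set.mem_Iio.1 hi'
      have := node_injOn (by omega) (by omega) h
      omega
    · obtain ⟨m, rfl⟩ : ∃ m', m = m' + 1 := ⟨m - 1, by omega⟩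
      rw [Icc_eq_empty (by omega), image_empty, hsymmOn_empty, map_zero]

/-- An empty column of the diagram contributes the last row `(0, …, 0, 1)`. -/
theorem det_coordMatrix_succ_right {n l N : ℕ} {c : ℕ → ℕ} (hl : l ≤ N) (hc : c (N - l) = 0) :
    (coordMatrix n l (N + 1) c).det = (coordMatrix n l N c).det := by
  rw [Matrix.det_succ_row _ (Fin.last N), sum_eq_single (Fin.last N)]
  · have h1 : coordMatrix n l (N + 1) c (Fin.last N) (Fin.last N) = 1 := by
      rw [coordMatrix, Matrix.of_apply, if_neg (by simpa using hl), if_pos le_rfl, Nat.sub_self,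
        hsymmOn_zero, map_one, pow_zero, one_mul]
    rw [h1, ← two_mul, pow_mul, neg_one_sq, one_pow, one_mul, one_mul]
    congr 1
    ext1 p q
    rw [Matrix.submatrix_apply, Fin.succAbove_last]
    rfl
  · intro q _ hq
    have hq' : (q : ℕ) < N := by
      have := q.2
      have : (q : ℕ) ≠ N := fun h => hq (Fin.ext h)
      omega
    have h1 : coordMatrix n l (N + 1) c (Fin.last N) q = 0 := by
      rw [coordMatrix, Matrix.of_apply, if_neg (by simpa using hl), if_pos (by simpa using hq'.le)]
      obtain ⟨m, hm⟩ : ∃ m, ((Fin.last N : Fin (N + 1)) : ℕ) - q = m + 1 :=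
        ⟨N - q - 1, by simp; omega⟩
      rw [hm, Fin.val_last, hc, Icc_eq_empty (by omega), image_empty, hsymmOn_empty, map_zero,
        mul_zero]
    rw [h1, mul_zero, zero_mul]
  · simp

/-- An unused extra row puts a single `Ω` at the top of a first column that is otherwise zero; this
is the new factor of `ξ`. -/
theorem det_coordMatrix_succ_succ {n l N : ℕ} {c : ℕ → ℕ} (hl : l + 1 ≤ n)
    (hc : ∀ s, l + s < N → c s ≤ l) :
    (coordMatrix n (l + 1) (N + 1) c).det =
      (Omega n (-(l : ZMod n)) : PS n) * (coordMatrix n l N c).det := by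
  rw [Matrix.det_succ_column_zero, sum_eq_single 0]
  · have h1 : coordMatrix n (l + 1) (N + 1) c 0 0 = (Omega n (-(l : ZMod n)) : PS n) := by
      rw [coordMatrix, Matrix.of_apply, if_pos (by simp), z, if_pos le_rfl, Nat.sub_self, zDiff,
        Fin.val_zero, natCast_label hl, node]
      push_cast
      congr 2
      ring
    rw [h1, Fin.val_zero, pow_zero, one_mul]
    congr 2
    ext1 p q
    rw [Matrix.submatrix_apply, coordMatrix, coordMatrix, Matrix.of_apply, Matrix.of_apply,
      Fin.zero_succAbove, Fin.val_succ, Fin.val_succ, Nat.add_sub_add_right,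
      Nat.add_sub_add_right]
    have e1 : ∀ k, n - (l + 1) + 1 + (k + 1) = n - l + 1 + k := fun k => by omega
    simp only [e1, Nat.add_lt_add_iff_right, Nat.add_le_add_iff_right]
  · intro p _ hp
    have hp' : 0 < (p : ℕ) := Fin.pos_iff_ne_zero.2 hp
    have h1 : coordMatrix n (l + 1) (N + 1) c p 0 = 0 := by
      rw [coordMatrix, Matrix.of_apply, Fin.val_zero, Nat.sub_zero]
      split_ifs with h1 h2
      · rw [z, if_neg (by omega)]
      · have h3 := hc (p - (l + 1)) (by omega)
        obtain ⟨m, hm⟩ : ∃ m, (p : ℕ) = m + 1 := ⟨p - 1, by omega⟩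
        have h4 : hsymmOn ((Icc (p : ℕ) (c (p - (l + 1)))).image fun t : ℕ =>
          (((p : ℕ) - (l + 1) + 1 : ℕ) : ZMod n) - (t : ZMod n))
            (fun r => e n (-wt n r)) (p : ℕ) = 0 := by
          rw [Icc_eq_empty (by omega), image_empty, hm, hsymmOn_empty]
        rw [h4, map_zero, mul_zero]
      · omega
    rw [h1, mul_zero, zero_mul]
  · simp

/-- `ξ` for `l` rows. -/
def xiOf (n l : ℕ) : (PS n)ˣ := ∏ k ∈ range l, Omega n (node n l k)

theorem xi_eq_xiOf (n : ℕ) (lam : YoungDiagram) : xi n lam = xiOf n (lam.colLen 0) := by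
  rw [xi, xiOf]
  refine prod_bij (fun i _ => lam.colLen 0 - i) (fun i hi => ?_) (fun i hi i' hi' h => ?_)
    (fun k hk => ⟨lam.colLen 0 - k, ?_, ?_⟩) (fun i hi => ?_)
  all_goals simp only [mem_Icc, mem_range] at *
  · omega
  · omega
  · omega
  · omega
  · rw [node, Nat.cast_sub hi.2]
    congr 1
    ring

theorem xiOf_succ (n l : ℕ) : xiOf n (l + 1) = xiOf n l * Omega n (-(l : ZMod n)) := by
  rw [xiOf, prod_range_succ', xiOf]
  congr 1
  · refine prod_congr rfl fun k _ => ?_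
    rw [node, node]
    congr 1
    push_cast
    ring
  · rw [node]
    congr 1
    push_cast
    ring

/-- The quotient `det M / ξ` for arbitrary sizes of the matrix. -/
def detQuot (n l N : ℕ) (c : ℕ → ℕ) : PS n :=
  (coordMatrix n l N c).det * (((xiOf n l)⁻¹ : (PS n)ˣ) : PS n)

theorem detQuot_succ_right {n l N : ℕ} {c : ℕ → ℕ} (hl : l ≤ N) (hc : c (N - l) = 0) :
    detQuot n l (N + 1) c = detQuot n l N c := by
  rw [detQuot, detQuot, det_coordMatrix_succ_right hl hc]

theorem detQuot_succ_succ {n l N : ℕ} {c : ℕ → ℕ} (hl : l + 1 ≤ n)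
    (hc : ∀ s, l + s < N → c s ≤ l) :
    detQuot n (l + 1) (N + 1) c = detQuot n l N c := by
  rw [detQuot, detQuot, det_coordMatrix_succ_succ hl hc, xiOf_succ, mul_inv, Units.val_mul]
  linear_combination ((coordMatrix n l N c).det * (((xiOf n l)⁻¹ : (PS n)ˣ) : PS n)) *
    Units.mul_inv (Omega n (-(l : ZMod n)))

/-- Removing a corner may shorten the first row or the first column. Padding allows both diagrams to
be compared in matrices of one size. -/
theorem detQuot_eq_of_le {n l l' r r' : ℕ} {c : ℕ → ℕ} (hl : l ≤ l') (hr : r ≤ r') (hn : l' ≤ n)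
    (hc : ∀ s, c s ≤ l) (hc0 : ∀ s, r ≤ s → c s = 0) :
    detQuot n l' (l' + r') c = detQuot n l (l + r) c := by
  induction hl with
  | refl =>
    induction hr with
    | refl => rfl
    | @step r' hr ih =>
      have hr' : r ≤ r' := hr
      rw [← ih, Nat.succ_eq_add_one, ← add_assoc, detQuot_succ_right (by omega) (hc0 _ (by omega))]
  | @step l' hl ih =>
    rw [← ih (by omega), Nat.succ_eq_add_one, add_right_comm,
      detQuot_succ_succ (by omega) fun s _ => (hc s).trans hl]

theorem swap_node {n l N j k : ℕ} (hN : N ≤ n) (hj : j + 1 < N) (hk : k < N) :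
    Equiv.swap (node n l j) (node n l j + 1) (node n l k) =
      node n l (Equiv.swap j (j + 1) k) := by
  rw [← node_succ]
  rcases eq_or_ne k j with rfl | h1
  · rw [Equiv.swap_apply_left, Equiv.swap_apply_left]
  rcases eq_or_ne k (j + 1) with rfl | h2
  · rw [Equiv.swap_apply_right, Equiv.swap_apply_right]
  rw [Equiv.swap_apply_of_ne_of_ne h1 h2, Equiv.swap_apply_of_ne_of_ne]
  · exact fun h => h1 (node_injOn (by omega) (by omega) h)
  · exact fun h => h2 (node_injOn (by omega) (by omega) h)

/-- The simple reflections, including the twisted one, act on `G / ξ` through `G`. -/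
theorem reflPS_mul_inv_xiOf {n l N j : ℕ} (hl : l ≤ N) (hN : N ≤ n) (hj : j + 1 < N) (G : PS n) :
    reflPS n (node n l j) (G * (((xiOf n l)⁻¹ : (PS n)ˣ) : PS n)) =
      permPS n (Equiv.swap (node n l j) (node n l j + 1)) G *
        (((xiOf n l)⁻¹ : (PS n)ˣ) : PS n) := by
  set σ := Equiv.swap (node n l j) (node n l j + 1) with hσ
  have hmap : ∀ i, Units.map (permPS n σ : PS n →* PS n) (Omega n i) = Omega n (σ i) := fun i =>
    Units.ext (permPS_Omega n σ i)
  have hinv : permPS n σ (((xiOf n l)⁻¹ : (PS n)ˣ) : PS n) =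
      (((∏ k ∈ range l, Omega n (node n l (Equiv.swap j (j + 1) k)))⁻¹ : (PS n)ˣ) : PS n) := by
    change ((Units.map (permPS n σ : PS n →* PS n) (xiOf n l)⁻¹ : (PS n)ˣ) : PS n) = _
    rw [map_inv, xiOf, map_prod]
    congr 2
    refine prod_congr rfl fun k hk => ?_
    have := mem_range.1 hk
    rw [hmap, hσ, swap_node hN hj (by omega)]
  -- `ξ` involves the first `l` nodes, so it changes only if `j + 1 = l`, which is exactly the case
  -- of residue `0`. Then `Ω(b_n)` becomes `Ω(b_1)`, and the twist in `s_0` compensates.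
  have hzero := node_eq_zero_iff (n := n) (l := l) (k := j) (by omega) (by omega)
  rw [reflPS]
  split_ifs with h0
  · have h1 : node n l j + 1 = 1 := by rw [h0, zero_add]
    have hσ' : Equiv.swap (1 : ZMod n) 0 = σ := by rw [hσ, h1, h0, Equiv.swap_comm]
    obtain rfl := hzero.1 h0
    have hxi : Omega n 1 * (Omega n 0)⁻¹ *
        (∏ k ∈ range (j + 1), Omega n (node n (j + 1) (Equiv.swap j (j + 1) k)))⁻¹ =
          (xiOf n (j + 1))⁻¹ := by
      have h2 : ∏ k ∈ range j, Omega n (node n (j + 1) (Equiv.swap j (j + 1) k)) =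
          ∏ k ∈ range j, Omega n (node n (j + 1) k) :=
        prod_range_swap (fun k => Omega n (node n (j + 1) k)) (by omega)
      rw [xiOf, prod_range_succ, prod_range_succ, Equiv.swap_apply_left, h2,
        node_succ, h1, h0, mul_inv, mul_inv]
      rw [mul_comm (Omega n 1), mul_mul_mul_comm, mul_inv_cancel, mul_one, mul_comm]
    rw [hσ', map_mul, hinv, ← hxi, Units.val_mul (Omega n 1 * (Omega n 0)⁻¹)]
    ring
  · rw [map_mul, hinv, prod_range_swap (fun k => Omega n (node n l k))
      (fun h => h0 (hzero.2 h.symm)), xiOf]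

/-- The Demazure operator adds a box at the bottom of the `s`-th column. -/
theorem D_detQuot {n l N j s : ℕ} {c : ℕ → ℕ} (hN : N ≤ n) (hsN : l + s < N)
    (hs : l + s - c s = j + 1) (hcs : c s < l)
    (hc : ∀ s', l + s' < N → c s' ≤ l)
    (hne : ∀ s', l + s' < N → s' ≠ s → l + s' - c s' ≠ j + 1) :
    D n (node n l j) (detQuot n l N c) =
      detQuot n l N (Function.update c s (c s + 1)) := by
  have hj : j + 1 < N := by omega
  have hdet : ∀ c' : ℕ → ℕ, (∀ s', l + s' < N → c' s' ≤ l) →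
      (coordMatrix n l N c').det * (evalMatrix (point n l) (fun _ => 1) N N c).det =
        (evalMatrix (point n l) (fun k => (Omega n (node n l k) : PS n)) l N c').det := by
    intro c' hc'
    have h1 : evalMatrix (point n l) (fun _ => 1) N N c =
        evalMatrix (point n l) (fun _ => 1) N N c' := by
      ext1 p k
      rw [evalMatrix, evalMatrix, Matrix.of_apply, Matrix.of_apply, if_pos p.2, if_pos p.2]
    rw [h1, ← Matrix.det_mul, coordMatrix_mul (by omega) hN hc']
  have hG := divided_difference_det (permPS n (Equiv.swap (node n l j) (node n l (j + 1))))
    (point n l) (fun k => (Omega n (node n l k) : PS n))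
    (u := MvPowerSeries.C (Ring.inverse (1 - e n (wt n (node n l j) - wt n (node n l (j + 1))))))
    (isUnit_point_sub_point hN)
    (fun k hk => ?_) (fun k hk => ?_) hsN hs hne ?_ (hdet c hc) (hdet _ fun s' hs' => ?_)
  · rw [D, detQuot, detQuot, reflPS_mul_inv_xiOf (by omega) hN hj, ← node_succ, ← hG]
    ring
  · rw [point, permPS_C, permRTD_b, node_succ, swap_node hN hj hk, point]
  · rw [permPS_Omega, node_succ, swap_node hN hj hk]
  · rw [point, point, ← map_sub, ← map_mul, inverse_mul_b_sub_b, map_sub, map_one]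
    intro h
    have := node_injOn (by omega) (by omega) h
    omega
  · rcases eq_or_ne s' s with rfl | h
    · rwa [Function.update_self]
    · rw [Function.update_of_ne h]
      exact hc s' hs'

/-! ### Removing a corner of a Young diagram -/

/-- The box `(a, b)` is a corner of `lam`. -/
def IsCorner (lam : YoungDiagram) (a b : ℕ) : Prop := lam.rowLen a = b + 1 ∧ lam.colLen b = a + 1

/-- The diagram without the corner `(a, b)`. -/
def removeCorner (lam : YoungDiagram) (a b : ℕ) (h : IsCorner lam a b) : YoungDiagram where
  cells := lam.cells.erase (a, b)
  isLowerSet := by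
    rintro ⟨i, j⟩ ⟨i', j'⟩ hle hmem
    simp only [coe_erase, Set.mem_sdiff, mem_coe, Set.mem_singleton_iff] at hmem ⊢
    refine ⟨lam.isLowerSet hle hmem.1, fun heq => hmem.2 ?_⟩
    obtain ⟨rfl, rfl⟩ := Prod.mk.inj heq
    have hle' := Prod.mk_le_mk.1 hle
    have h1 : (i, j) ∈ lam := hmem.1
    have h2 := YoungDiagram.mem_iff_lt_rowLen.1 (lam.up_left_mem hle'.1 le_rfl h1)
    have h3 := YoungDiagram.mem_iff_lt_colLen.1 (lam.up_left_mem le_rfl hle'.2 h1)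
    rw [h.1] at h2
    rw [h.2] at h3
    rw [show i = i' by omega, show j = j' by omega]

theorem mem_removeCorner {lam : YoungDiagram} {a b : ℕ} (h : IsCorner lam a b) {x : ℕ × ℕ} :
    x ∈ removeCorner lam a b h ↔ x ≠ (a, b) ∧ x ∈ lam := mem_erase

theorem IsCorner.mem {lam : YoungDiagram} {a b : ℕ} (h : IsCorner lam a b) : (a, b) ∈ lam :=
  YoungDiagram.mem_iff_lt_rowLen.2 (by rw [h.1]; omega)

theorem card_removeCorner {lam : YoungDiagram} {a b : ℕ} (h : IsCorner lam a b) :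
    (removeCorner lam a b h).card + 1 = lam.card :=
  card_erase_add_one h.mem

theorem rowLen_removeCorner {lam : YoungDiagram} {a b : ℕ} (h : IsCorner lam a b) (i : ℕ) :
    (removeCorner lam a b h).rowLen i = if i = a then b else lam.rowLen i := by
  refine eq_of_forall_lt_iff fun j => ?_
  rw [← YoungDiagram.mem_iff_lt_rowLen, mem_removeCorner, YoungDiagram.mem_iff_lt_rowLen, Ne,
    Prod.mk.injEq]
  split_ifs with hi
  · subst hi
    rw [h.1]
    omega
  · tauto

theorem colLen_removeCorner {lam : YoungDiagram} {a b : ℕ} (h : IsCorner lam a b) :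
    (removeCorner lam a b h).colLen = Function.update lam.colLen b a := by
  funext j
  refine eq_of_forall_lt_iff fun i => ?_
  rw [← YoungDiagram.mem_iff_lt_colLen, mem_removeCorner, YoungDiagram.mem_iff_lt_colLen, Ne,
    Prod.mk.injEq, Function.update_apply]
  split_ifs with hj
  · subst hj
    rw [h.2]
    omega
  · tauto

theorem exists_isCorner {lam : YoungDiagram} (h : lam.card ≠ 0) : ∃ a b, IsCorner lam a b := by
  obtain ⟨⟨i, j⟩, hij⟩ := card_pos.1 (Nat.pos_of_ne_zero h)
  have h0 : 0 < lam.colLen 0 :=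
    YoungDiagram.mem_iff_lt_colLen.1
      (lam.up_left_mem (Nat.zero_le i) (Nat.zero_le j) ((YoungDiagram.mem_cells _).1 hij))
  have h1 : (lam.colLen 0 - 1, 0) ∈ lam := YoungDiagram.mem_iff_lt_colLen.2 (by omega)
  have h2 := YoungDiagram.mem_iff_lt_rowLen.1 h1
  set b := lam.rowLen (lam.colLen 0 - 1) - 1 with hb
  have h3 : (lam.colLen 0 - 1, b) ∈ lam := YoungDiagram.mem_iff_lt_rowLen.2 (by omega)
  have h4 := YoungDiagram.mem_iff_lt_colLen.1 h3
  have h5 := lam.colLen_anti 0 b (Nat.zero_le _)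
  exact ⟨lam.colLen 0 - 1, b, by omega, by omega⟩

theorem rowLen_removeCorner_le {lam : YoungDiagram} {a b : ℕ} (h : IsCorner lam a b) (i : ℕ) :
    (removeCorner lam a b h).rowLen i ≤ lam.rowLen i := by
  rw [rowLen_removeCorner]
  split_ifs with hi
  · rw [hi, h.1]
    omega
  · exact le_rfl

theorem colLen_removeCorner_le {lam : YoungDiagram} {a b : ℕ} (h : IsCorner lam a b) (j : ℕ) :
    (removeCorner lam a b h).colLen j ≤ lam.colLen j := by
  rw [colLen_removeCorner, Function.update_apply]
  split_ifs with hj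
  · rw [hj, h.2]
    omega
  · exact le_rfl

theorem IsKSmall.removeCorner {n : ℕ} {lam : YoungDiagram} {a b : ℕ} (hlam : IsKSmall n lam)
    (h : IsCorner lam a b) : IsKSmall n (removeCorner lam a b h) :=
  (Nat.add_le_add (rowLen_removeCorner_le h 0) (colLen_removeCorner_le h 0)).trans hlam

/-- The quotient `det M / ξ`. -/
def detQuotOf (n : ℕ) (lam : YoungDiagram) : PS n :=
  detQuot n (lam.colLen 0) (lam.colLen 0 + lam.rowLen 0) lam.colLen

theorem D_detQuotOf {n : ℕ} {lam : YoungDiagram} {a b : ℕ} (hlam : IsKSmall n lam)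
    (h : IsCorner lam a b) :
    D n ((b : ZMod n) - a) (detQuotOf n (removeCorner lam a b h)) = detQuotOf n lam := by
  have hlam' : lam.rowLen 0 + lam.colLen 0 ≤ n := hlam
  have hb := lam.colLen_anti 0 b (Nat.zero_le _)
  have ha := lam.rowLen_anti 0 a (Nat.zero_le _)
  rw [h.1] at ha
  rw [h.2] at hb
  have hcol : (removeCorner lam a b h).colLen b = a := by
    rw [colLen_removeCorner, Function.update_self]
  have hupd : lam.colLen = Function.update (removeCorner lam a b h).colLen b
      ((removeCorner lam a b h).colLen b + 1) := by
    rw [hcol, colLen_removeCorner, Function.update_idem, ← h.2, Function.update_eq_self]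
  have h1 : detQuotOf n (removeCorner lam a b h) = detQuot n (lam.colLen 0)
      (lam.colLen 0 + lam.rowLen 0) (removeCorner lam a b h).colLen := by
    rw [detQuotOf]
    refine (detQuot_eq_of_le (colLen_removeCorner_le h 0) (rowLen_removeCorner_le h 0) (by omega)
      (fun s => YoungDiagram.colLen_anti _ 0 s (Nat.zero_le _)) fun s hs => ?_).symm
    by_contra h0
    have h2 := YoungDiagram.mem_iff_lt_rowLen.1
      (YoungDiagram.mem_iff_lt_colLen.2 (Nat.pos_of_ne_zero h0))
    omega
  have hnode : (b : ZMod n) - a = node n (lam.colLen 0) (lam.colLen 0 + b - a - 1) := by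
    rw [node, Nat.cast_sub (by omega), Nat.cast_sub (by omega)]
    push_cast
    ring
  rw [h1, hnode, D_detQuot (s := b) (by omega) (by omega) (by omega) (by omega) (fun s _ => ?_)
    (fun s hs hne => ?_), ← hupd, detQuotOf]
  · exact (YoungDiagram.colLen_anti _ 0 s (Nat.zero_le _)).trans (colLen_removeCorner_le h 0)
  -- Column lengths decrease weakly, so the degrees `l + s - c s` increase strictly and no other
  -- column shares the degree of column `b`.
  · have h2 := (YoungDiagram.colLen_anti _ 0 s (Nat.zero_le _)).trans (colLen_removeCorner_le h 0)
    rcases lt_or_gt_of_ne hne with hlt | hlt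
    · have h3 := (removeCorner lam a b h).colLen_anti s b hlt.le
      omega
    · have h3 := (removeCorner lam a b h).colLen_anti b s hlt.le
      omega

/-! ### The residue word -/

theorem commute_simple {n : ℕ} {i j : ZMod n} (h0 : i ≠ j) (h1 : j ≠ i + 1) (h2 : i ≠ j + 1) :
    Commute ((affineSystem n).simple i) ((affineSystem n).simple j) := by
  have hM : affineMatrix n i j = if n = 2 then 0 else 2 := by
    change (if i = j then 1 else if n = 2 then 0 else if j = i + 1 ∨ i = j + 1 then 3 else 2) = _
    rw [if_neg h0, if_neg (show ¬(j = i + 1 ∨ i = j + 1) by tauto)]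
  rcases eq_or_ne n 2 with rfl | hn
  · exfalso
    have key : ∀ i j : ZMod 2, i ≠ j → j ≠ i + 1 → False := by decide
    exact key i j h0 h1
  · have h := (affineSystem n).simple_mul_simple_pow i j
    rw [hM, if_neg hn, pow_two] at h
    have h3 := eq_inv_of_mul_eq_one_left h
    rwa [mul_inv_rev, (affineSystem n).inv_simple, (affineSystem n).inv_simple] at h3

/-- The residues of a row, read from left to right. -/
def rowWord (n : ℕ) (lam : YoungDiagram) (i : ℕ) : List (ZMod n) :=
  (List.range (lam.rowLen i)).map fun j : ℕ => (j : ZMod n) - (i : ZMod n)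

/-- The residues of the first `N` rows. -/
def rowsWord (n : ℕ) (lam : YoungDiagram) (N : ℕ) : List (ZMod n) :=
  (List.range N).flatMap (rowWord n lam)

theorem rowsWord_succ (n : ℕ) (lam : YoungDiagram) (N : ℕ) :
    rowsWord n lam (N + 1) = rowsWord n lam N ++ rowWord n lam N := by
  rw [rowsWord, List.range_succ, List.flatMap_append, List.flatMap_singleton, rowsWord]

theorem rowsWord_of_le (n : ℕ) (lam : YoungDiagram) {N : ℕ} (h : lam.colLen 0 ≤ N) :
    rowsWord n lam N = rowsWord n lam (lam.colLen 0) := by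
  induction h with
  | refl => rfl
  | @step N h ih =>
    have h' : lam.colLen 0 ≤ N := h
    have h0 : lam.rowLen N = 0 := by
      by_contra h0
      have := YoungDiagram.mem_iff_lt_colLen.1
        (YoungDiagram.mem_iff_lt_rowLen.2 (Nat.pos_of_ne_zero h0))
      omega
    rw [Nat.succ_eq_add_one, rowsWord_succ, ih, rowWord, h0, List.range_zero, List.map_nil,
      List.append_nil]

theorem affineGrassmannian_eq (n : ℕ) (lam : YoungDiagram) {N : ℕ} (h : lam.colLen 0 ≤ N) :
    affineGrassmannian n lam = ((affineSystem n).wordProd (rowsWord n lam N))⁻¹ := by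
  rw [rowsWord_of_le n lam h, ← CoxeterSystem.wordProd_reverse]
  rfl

theorem commute_wordProd {n : ℕ} {i : ZMod n} {ω : List (ZMod n)}
    (h : ∀ j ∈ ω, i ≠ j ∧ j ≠ i + 1 ∧ i ≠ j + 1) :
    Commute ((affineSystem n).simple i) ((affineSystem n).wordProd ω) := by
  induction ω with
  | nil =>
    rw [CoxeterSystem.wordProd_nil]
    exact Commute.one_right _
  | cons j ω ih =>
    rw [CoxeterSystem.wordProd_cons]
    obtain ⟨h0, h1, h2⟩ := h j List.mem_cons_self
    exact (commute_simple h0 h1 h2).mul_right (ih fun k hk => h k (List.mem_cons_of_mem _ hk))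

theorem natCast_zmod_ne_zero {n d : ℕ} (h0 : 0 < d) (hd : d < n) : (d : ZMod n) ≠ 0 := by
  rw [Ne, ZMod.natCast_eq_zero_iff]
  exact fun h => absurd (Nat.le_of_dvd h0 h) (by omega)

/-- The boxes in lower rows lie strictly to the left of the corner. By `k`-smallness their residues
are neither equal nor adjacent to that of the corner, so its letter commutes past them. -/
theorem affineGrassmannian_removeCorner {n : ℕ} {lam : YoungDiagram} {a b : ℕ}
    (hlam : IsKSmall n lam) (h : IsCorner lam a b) :
    affineGrassmannian n lam =
      (affineSystem n).simple ((b : ZMod n) - a) *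
        affineGrassmannian n (removeCorner lam a b h) := by
  have hlam' : lam.rowLen 0 + lam.colLen 0 ≤ n := hlam
  have hb := lam.colLen_anti 0 b (Nat.zero_le _)
  have ha := lam.rowLen_anti 0 a (Nat.zero_le _)
  rw [h.1] at ha
  rw [h.2] at hb
  have hrow : ∀ i, i ≠ a → rowWord n (removeCorner lam a b h) i = rowWord n lam i := fun i hi => by
    rw [rowWord, rowWord, rowLen_removeCorner, if_neg hi]
  have hrow_a : rowWord n lam a =
      rowWord n (removeCorner lam a b h) a ++ [(b : ZMod n) - a] := by
    rw [rowWord, rowWord, rowLen_removeCorner, if_pos rfl, h.1, List.range_succ, List.map_append,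
      List.map_singleton]
  have hlow : ∀ N ≤ a, rowsWord n (removeCorner lam a b h) N = rowsWord n lam N := by
    intro N hN
    induction N with
    | zero => rfl
    | succ N ih => rw [rowsWord_succ, rowsWord_succ, ih (by omega), hrow N (by omega)]
  have hhigh : ∀ N, a + 1 ≤ N → N ≤ lam.colLen 0 →
      (affineSystem n).wordProd (rowsWord n lam N) =
        (affineSystem n).wordProd (rowsWord n (removeCorner lam a b h) N) *
          (affineSystem n).simple ((b : ZMod n) - a) := by
    intro N hN
    induction N, hN using Nat.le_induction with
    | base =>
      intro _
      rw [rowsWord_succ, rowsWord_succ, hlow a le_rfl, hrow_a, ← List.append_assoc,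
        CoxeterSystem.wordProd_append, CoxeterSystem.wordProd_singleton]
    | succ N hN ih =>
      intro hNl
      have hcomm : Commute ((affineSystem n).simple ((b : ZMod n) - a))
          ((affineSystem n).wordProd (rowWord n lam N)) := by
        refine commute_wordProd fun k hk => ?_
        rw [rowWord, List.mem_map] at hk
        obtain ⟨j, hj, rfl⟩ := hk
        have hj' := List.mem_range.1 hj
        have hjb : j < b := by
          by_contra hjb
          have h1 := YoungDiagram.mem_iff_lt_colLen.1
            (lam.up_left_mem le_rfl (show b ≤ j by omega)
              (YoungDiagram.mem_iff_lt_rowLen.2 hj'))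
          rw [h.2] at h1
          omega
        have hd : ∀ d : ℤ, ∀ m : ℕ, 0 < m → m < n → (m : ℤ) = (b - a) - (j - N) + d →
            ((b : ZMod n) - a) - (j - N) + d ≠ 0 := by
          intro d m hm0 hmn hm
          have h1 := natCast_zmod_ne_zero hm0 hmn
          have h2 := congrArg (Int.cast : ℤ → ZMod n) hm
          push_cast at h2
          rwa [← h2]
        refine ⟨fun heq => ?_, fun heq => ?_, fun heq => ?_⟩
        · refine hd 0 (b - j + (N - a)) (by omega) (by omega) (by omega) ?_
          push_cast
          linear_combination heq
        · refine hd 1 (b - j + (N - a) + 1) (by omega) (by omega) (by omega) ?_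
          push_cast
          linear_combination -heq
        · refine hd (-1) (b - j + (N - a) - 1) (by omega) (by omega) (by omega) ?_
          push_cast
          linear_combination heq
      rw [rowsWord_succ, rowsWord_succ, CoxeterSystem.wordProd_append,
        CoxeterSystem.wordProd_append, ih (by omega), hrow N (by omega), mul_assoc, mul_assoc,
        hcomm.eq]
  rw [affineGrassmannian_eq n lam le_rfl, hhigh _ hb le_rfl,
    affineGrassmannian_eq n _ (colLen_removeCorner_le h 0), mul_inv_rev,
    CoxeterSystem.inv_simple]

/-! ### The affine symmetric group acting on the integers -/

/-- The affine transposition exchanging `z` and `z + 1` for all `z` of residue `i`. -/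
def affineStep (n : ℕ) (i : ZMod n) (z : ℤ) : ℤ :=
  if (z : ZMod n) = i then z + 1 else if (z : ZMod n) = i + 1 then z - 1 else z

section

variable {n : ℕ}

theorem one_ne_zero_zmod (hn : 2 ≤ n) : (1 : ZMod n) ≠ 0 := by
  have := natCast_zmod_ne_zero (n := n) (d := 1) one_pos (by omega)
  rwa [Nat.cast_one] at this

theorem affineStep_of_eq {i : ZMod n} {z : ℤ} (h : (z : ZMod n) = i) :
    affineStep n i z = z + 1 := if_pos h

theorem affineStep_of_eq_add_one (hn : 2 ≤ n) {i : ZMod n} {z : ℤ} (h : (z : ZMod n) = i + 1) :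
    affineStep n i z = z - 1 := by
  rw [affineStep, if_neg, if_pos h]
  rw [h]
  simpa using one_ne_zero_zmod hn

theorem affineStep_of_ne {i : ZMod n} {z : ℤ} (h : (z : ZMod n) ≠ i) (h' : (z : ZMod n) ≠ i + 1) :
    affineStep n i z = z := by rw [affineStep, if_neg h, if_neg h']

theorem affineStep_involutive (hn : 2 ≤ n) (i : ZMod n) :
    Function.Involutive (affineStep n i) := by
  intro z
  by_cases h : (z : ZMod n) = i
  · rw [affineStep_of_eq h, affineStep_of_eq_add_one hn (by push_cast; rw [h])]
    ring
  · by_cases h' : (z : ZMod n) = i + 1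
    · rw [affineStep_of_eq_add_one hn h', affineStep_of_eq (by push_cast; rw [h']; ring)]
      ring
    · rw [affineStep_of_ne h h', affineStep_of_ne h h']

theorem affineStep_cast (hn : 2 ≤ n) (i : ZMod n) (z : ℤ) :
    ((affineStep n i z : ℤ) : ZMod n) = Equiv.swap i (i + 1) (z : ZMod n) := by
  by_cases h : (z : ZMod n) = i
  · rw [affineStep_of_eq h, h, Equiv.swap_apply_left]
    push_cast
    rw [h]
  · by_cases h' : (z : ZMod n) = i + 1
    · rw [affineStep_of_eq_add_one hn h', h', Equiv.swap_apply_right]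
      push_cast
      rw [h']
      ring
    · rw [affineStep_of_ne h h', Equiv.swap_apply_of_ne_of_ne h h']

theorem affineStep_comm_of_mem (hn : 2 ≤ n) {i j : ZMod n} (h0 : i ≠ j) (h1 : j ≠ i + 1)
    (h2 : i ≠ j + 1) {z : ℤ} (hz : (z : ZMod n) = i ∨ (z : ZMod n) = i + 1) :
    affineStep n i (affineStep n j z) = affineStep n j (affineStep n i z) := by
  have e0 : i + 1 ≠ j + 1 := fun h => h0 (add_right_cancel h)
  have key : ∀ w : ℤ, ((w : ZMod n) = i ∨ (w : ZMod n) = i + 1) → affineStep n j w = w := by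
    rintro w (hw | hw)
    · exact affineStep_of_ne (by rwa [hw]) (by rwa [hw])
    · exact affineStep_of_ne (by rw [hw]; exact h1.symm) (by rwa [hw])
  rw [key z hz, key]
  rw [affineStep_cast hn]
  rcases hz with hz | hz <;> rw [hz] <;> simp

theorem affineStep_comm (hn : 2 ≤ n) {i j : ZMod n} (h0 : i ≠ j) (h1 : j ≠ i + 1)
    (h2 : i ≠ j + 1) (z : ℤ) :
    affineStep n i (affineStep n j z) = affineStep n j (affineStep n i z) := by
  by_cases hi : (z : ZMod n) = i ∨ (z : ZMod n) = i + 1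
  · exact affineStep_comm_of_mem hn h0 h1 h2 hi
  by_cases hj : (z : ZMod n) = j ∨ (z : ZMod n) = j + 1
  · exact (affineStep_comm_of_mem hn h0.symm h2 h1 hj).symm
  push Not at hi hj
  rw [affineStep_of_ne hi.1 hi.2, affineStep_of_ne hj.1 hj.2, affineStep_of_ne hi.1 hi.2]

theorem affineStep_braid (hn : 3 ≤ n) (i : ZMod n) (z : ℤ) :
    affineStep n i (affineStep n (i + 1) (affineStep n i z)) =
      affineStep n (i + 1) (affineStep n i (affineStep n (i + 1) z)) := by
  have e1 : (1 : ZMod n) ≠ 0 := one_ne_zero_zmod (by omega)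
  have e2 : (2 : ZMod n) ≠ 0 := by
    have := natCast_zmod_ne_zero (n := n) (d := 2) two_pos (by omega)
    rwa [Nat.cast_two] at this
  have h01 : i ≠ i + 1 := fun h => e1 (by linear_combination -h)
  have h02 : i ≠ i + 1 + 1 := fun h => e2 (by linear_combination -h)
  by_cases h0 : (z : ZMod n) = i
  · have a1 : ((z + 1 : ℤ) : ZMod n) = i + 1 := by push_cast; rw [h0]
    have a2 : ((z + 1 + 1 : ℤ) : ZMod n) = i + 1 + 1 := by push_cast; rw [h0]
    rw [affineStep_of_eq h0, affineStep_of_eq a1,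
      affineStep_of_ne (by rw [a2]; exact h02.symm) (by rw [a2]; simpa using e1),
      affineStep_of_ne (i := i + 1) (z := z) (by rwa [h0]) (by rwa [h0]), affineStep_of_eq h0,
      affineStep_of_eq a1]
  by_cases h1 : (z : ZMod n) = i + 1
  · have a1 : ((z - 1 : ℤ) : ZMod n) = i := by push_cast; rw [h1]; ring
    have a2 : ((z + 1 : ℤ) : ZMod n) = i + 1 + 1 := by push_cast; rw [h1]
    rw [affineStep_of_eq_add_one (by omega) h1,
      affineStep_of_ne (i := i + 1) (z := z - 1) (by rwa [a1]) (by rwa [a1]), affineStep_of_eq a1,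
      affineStep_of_eq h1, affineStep_of_ne (i := i) (z := z + 1) (by rw [a2]; exact h02.symm)
        (by rw [a2]; simpa using e1), affineStep_of_eq_add_one (by omega) a2]
    ring
  by_cases h2 : (z : ZMod n) = i + 1 + 1
  · have a1 : ((z - 1 : ℤ) : ZMod n) = i + 1 := by push_cast; rw [h2]; ring
    have a2 : ((z - 1 - 1 : ℤ) : ZMod n) = i := by push_cast; rw [h2]; ring
    rw [affineStep_of_ne h0 h1, affineStep_of_eq_add_one (by omega) h2,
      affineStep_of_eq_add_one (by omega) a1, affineStep_of_ne (by rwa [a2]) (by rwa [a2])]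
  · rw [affineStep_of_ne h0 h1, affineStep_of_ne h1 h2, affineStep_of_ne h0 h1,
      affineStep_of_ne h1 h2]

/-- `affineStep` as a permutation. -/
def affineStepPerm (hn : 2 ≤ n) (i : ZMod n) : Equiv.Perm ℤ :=
  (affineStep_involutive hn i).toPerm

theorem affineStepPerm_apply (hn : 2 ≤ n) (i : ZMod n) (z : ℤ) :
    affineStepPerm hn i z = affineStep n i z := rfl

theorem affineStepPerm_mul_self (hn : 2 ≤ n) (i : ZMod n) :
    affineStepPerm hn i * affineStepPerm hn i = 1 :=
  Equiv.ext fun z => affineStep_involutive hn i z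

theorem isLiftable_affineStepPerm (hn : 2 ≤ n) :
    (affineMatrix n).IsLiftable (affineStepPerm hn) := by
  have hbraid : 3 ≤ n → ∀ i : ZMod n,
      (affineStepPerm hn i * affineStepPerm hn (i + 1)) ^ 3 = 1 := by
    intro hn3 i
    have h1 : affineStepPerm hn i * affineStepPerm hn (i + 1) * affineStepPerm hn i =
        affineStepPerm hn (i + 1) * affineStepPerm hn i * affineStepPerm hn (i + 1) :=
      Equiv.ext fun z => affineStep_braid hn3 i z
    calc (affineStepPerm hn i * affineStepPerm hn (i + 1)) ^ 3
        = (affineStepPerm hn i * affineStepPerm hn (i + 1) * affineStepPerm hn i) *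
          (affineStepPerm hn (i + 1) * affineStepPerm hn i * affineStepPerm hn (i + 1)) := by
          simp only [pow_succ, pow_zero, one_mul, mul_assoc]
      _ = 1 := by
          rw [h1]
          simp only [mul_assoc]
          rw [← mul_assoc (affineStepPerm hn (i + 1)) (affineStepPerm hn (i + 1)),
            affineStepPerm_mul_self, one_mul, ← mul_assoc (affineStepPerm hn i),
            affineStepPerm_mul_self, one_mul, affineStepPerm_mul_self]
  intro i j
  change (affineStepPerm hn i * affineStepPerm hn j) ^
    (if i = j then 1 else if n = 2 then 0 else if j = i + 1 ∨ i = j + 1 then 3 else 2) = 1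
  split_ifs with h1 h2 h3
  · rw [h1, pow_one, affineStepPerm_mul_self]
  · rw [pow_zero]
  · rcases h3 with rfl | rfl
    · exact hbraid (by omega) i
    · have h4 := hbraid (by omega) j
      have hinv : ∀ k, (affineStepPerm hn k)⁻¹ = affineStepPerm hn k := fun k =>
        inv_eq_of_mul_eq_one_left (affineStepPerm_mul_self hn k)
      have h5 := congrArg (·⁻¹) h4
      simp only [← inv_pow, mul_inv_rev, hinv, inv_one] at h5
      exact h5
  · have hc : affineStepPerm hn i * affineStepPerm hn j =
        affineStepPerm hn j * affineStepPerm hn i :=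
      Equiv.ext fun z => affineStep_comm hn h1 (fun h => h3 (Or.inl h)) (fun h => h3 (Or.inr h)) z
    rw [pow_two, mul_assoc, ← mul_assoc (affineStepPerm hn j), ← hc,
      mul_assoc (affineStepPerm hn i), affineStepPerm_mul_self, mul_one, affineStepPerm_mul_self]

/-- The action of the affine Weyl group on the integers. -/
def affineAction (hn : 2 ≤ n) : AffineWeyl n →* Equiv.Perm ℤ :=
  (affineSystem n).lift ⟨affineStepPerm hn, isLiftable_affineStepPerm hn⟩

theorem affineAction_simple_mul (hn : 2 ≤ n) (i : ZMod n) (w : AffineWeyl n) (z : ℤ) :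
    affineAction hn ((affineSystem n).simple i * w) z =
      affineStep n i (affineAction hn w z) := by
  rw [map_mul, Equiv.Perm.mul_apply, affineAction, CoxeterSystem.lift_apply_simple,
    affineStepPerm_apply]

/-! ### Configurations and their energy -/

theorem add_one_ediv {N d : ℤ} (hN : 0 < N) (h : ¬ N ∣ d + 1) : (d + 1) / N = d / N := by
  have h1 := Int.emod_add_mul_ediv d N
  have h2 := Int.emod_nonneg d hN.ne'
  have h3 := Int.emod_lt_of_pos d hN
  have h4 : d % N + 1 ≠ N := fun h4 => h ⟨d / N + 1, by linear_combination h4 - h1⟩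
  rw [Int.ediv_eq_iff_of_pos hN]
  have h5 : d % N + 1 < N := lt_of_le_of_ne h3 h4
  have h6 := mul_comm N (d / N)
  constructor <;> linarith

theorem intCast_ne_iff {x y : ℤ} : (x : ZMod n) ≠ y ↔ ¬ (n : ℤ) ∣ x - y := by
  rw [Ne, ← sub_eq_zero, ← Int.cast_sub, ZMod.intCast_zmod_eq_zero_iff_dvd]

/-- The quotient grows only if the difference reaches a multiple of `n`. A difference growing by one
cannot, since the residues stay distinct; a growth by two needs `x` to go up and `y` down. -/
theorem affineStep_sub_ediv (hn : 2 ≤ n) (i : ZMod n) {x y : ℤ} (hxy : (x : ZMod n) ≠ y) :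
    (affineStep n i x - affineStep n i y) / (n : ℤ) ≤ (x - y) / n +
      if (x : ZMod n) = i ∧ (y : ZMod n) = i + 1 then 1 else 0 := by
  have hN : (0 : ℤ) < n := by omega
  have hdvd := intCast_ne_iff.1 hxy
  have hdvd' : ¬ (n : ℤ) ∣ x - y - 1 + 1 := by rwa [sub_add_cancel]
  by_cases hx : (x : ZMod n) = i
  · rw [affineStep_of_eq hx]
    by_cases hy : (y : ZMod n) = i + 1
    · rw [affineStep_of_eq_add_one hn hy, if_pos ⟨hx, hy⟩, ← Int.add_mul_ediv_right _ _ hN.ne']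
      exact Int.ediv_le_ediv hN (by omega)
    · rw [affineStep_of_ne (fun h => hxy (hx.trans h.symm)) hy, if_neg fun h => hy h.2, add_zero,
        show x + 1 - y = x - y + 1 by ring, add_one_ediv hN]
      rw [show x - y + 1 = x + 1 - y by ring, ← intCast_ne_iff]
      push_cast
      rw [hx]
      exact Ne.symm hy
  · rw [if_neg fun h => hx h.1, add_zero]
    by_cases hx' : (x : ZMod n) = i + 1
    · rw [affineStep_of_eq_add_one hn hx']
      by_cases hy : (y : ZMod n) = i
      · rw [affineStep_of_eq hy]
        exact Int.ediv_le_ediv hN (by omega)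
      · rw [affineStep_of_ne hy fun h => hxy (hx'.trans h.symm),
          show x - 1 - y = x - y - 1 by ring, ← add_one_ediv hN hdvd', sub_add_cancel]
    · rw [affineStep_of_ne hx hx']
      by_cases hy : (y : ZMod n) = i
      · rw [affineStep_of_eq hy, show x - (y + 1) = x - y - 1 by ring, ← add_one_ediv hN hdvd',
          sub_add_cancel]
      · by_cases hy' : (y : ZMod n) = i + 1
        · rw [affineStep_of_eq_add_one hn hy', show x - (y - 1) = x - y + 1 by ring,
            add_one_ediv hN]
          rw [show x - y + 1 = x + 1 - y by ring, ← intCast_ne_iff]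
          push_cast
          rw [hy']
          exact fun h => hx (add_right_cancel h)
        · rw [affineStep_of_ne hy hy']

end

section

variable {n : ℕ}

/-- The beads and the shifted gaps of the abacus of `lam`, labelled by rows and columns. -/
def position (n : ℕ) (lam : YoungDiagram) : ℕ ⊕ ℕ → ℤ
  | .inl a => lam.rowLen a - a
  | .inr b => b + 1 - lam.colLen b - n

/-- The labels of the rows and columns of an `(n - r) × r` rectangle. -/
def labels (n r : ℕ) : Set (ℕ ⊕ ℕ) := {u | Sum.elim (· < n - r) (· < r) u}

theorem inl_mem_labels {r a : ℕ} : Sum.inl a ∈ labels n r ↔ a < n - r := Iff.rfl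

theorem inr_mem_labels {r b : ℕ} : Sum.inr b ∈ labels n r ↔ b < r := Iff.rfl

/-- The number of pairs of a row and a column, weighted by the distance of their positions. -/
def energy (n r : ℕ) (P : ℕ ⊕ ℕ → ℤ) : ℤ :=
  ∑ u ∈ range (n - r) ×ˢ range r, (P (.inl u.1) - P (.inr u.2)) / n

theorem energy_congr {r : ℕ} {P Q : ℕ ⊕ ℕ → ℤ} (h : ∀ u ∈ labels n r, P u = Q u) :
    energy n r P = energy n r Q := by
  refine sum_congr rfl fun u hu => ?_
  obtain ⟨h1, h2⟩ := mem_product.1 hu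
  rw [h _ (inl_mem_labels.2 (mem_range.1 h1)), h _ (inr_mem_labels.2 (mem_range.1 h2))]

/-- Distinct labels have positions of distinct residues. -/
def ResidueInjOn (n r : ℕ) (P : ℕ ⊕ ℕ → ℤ) : Prop :=
  Set.InjOn (fun u => (P u : ZMod n)) (labels n r)

theorem ResidueInjOn.affineStep (hn : 2 ≤ n) {r : ℕ} {P : ℕ ⊕ ℕ → ℤ} (hP : ResidueInjOn n r P)
    (i : ZMod n) : ResidueInjOn n r fun u => affineStep n i (P u) := by
  intro u hu v hv h
  simp only [affineStep_cast hn] at h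
  exact hP hu hv ((Equiv.injective _) h)

theorem ResidueInjOn.ne {r : ℕ} {P : ℕ ⊕ ℕ → ℤ} (hP : ResidueInjOn n r P) {a b : ℕ}
    (ha : a < n - r) (hb : b < r) : (P (.inl a) : ZMod n) ≠ P (.inr b) := fun h =>
  Sum.inl_ne_inr (hP (inl_mem_labels.2 ha) (inr_mem_labels.2 hb) h)

/-- Distinct residues leave at most one pair whose term can grow. -/
theorem energy_affineStep_le (hn : 2 ≤ n) {r : ℕ} {P : ℕ ⊕ ℕ → ℤ} (hP : ResidueInjOn n r P)
    (i : ZMod n) : energy n r (fun u => affineStep n i (P u)) ≤ energy n r P + 1 := by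
  have h1 : ∑ u ∈ range (n - r) ×ˢ range r,
      (if (P (.inl u.1) : ZMod n) = i ∧ (P (.inr u.2) : ZMod n) = i + 1 then (1 : ℤ) else 0) ≤
        1 := by
    rw [← sum_filter, sum_const, nsmul_eq_mul, mul_one]
    norm_cast
    refine card_le_one.2 fun u hu v hv => ?_
    simp only [mem_filter, mem_product, mem_range] at hu hv
    have h2 := hP (inl_mem_labels.2 hu.1.1) (inl_mem_labels.2 hv.1.1)
      (hu.2.1.trans hv.2.1.symm)
    have h3 := hP (inr_mem_labels.2 hu.1.2) (inr_mem_labels.2 hv.1.2)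
      (hu.2.2.trans hv.2.2.symm)
    exact Prod.ext (Sum.inl_injective h2) (Sum.inr_injective h3)
  refine le_trans ?_ (add_le_add_right h1 _)
  rw [energy, energy, ← sum_add_distrib]
  refine sum_le_sum fun u hu => ?_
  simp only [mem_product, mem_range] at hu
  exact affineStep_sub_ediv hn i (hP.ne hu.1 hu.2)

theorem exists_of_energy_affineStep_lt (hn : 2 ≤ n) {r : ℕ} {P : ℕ ⊕ ℕ → ℤ}
    (hP : ResidueInjOn n r P) {i : ZMod n}
    (h : energy n r (fun u => affineStep n i (P u)) < energy n r P) :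
    ∃ a < n - r, ∃ b < r, (P (.inl a) : ZMod n) = i + 1 ∧ (P (.inr b) : ZMod n) = i := by
  obtain ⟨u, hu, hlt⟩ := exists_lt_of_sum_lt h
  beta_reduce at hlt
  simp only [mem_product, mem_range] at hu
  refine ⟨u.1, hu.1, u.2, hu.2, ?_⟩
  -- The step is an involution, so a decrease is an increase for the step applied to the moved
  -- positions.
  have h1 := affineStep_sub_ediv hn i ((hP.affineStep hn i).ne hu.1 hu.2)
  rw [affineStep_involutive hn, affineStep_involutive hn, affineStep_cast hn,
    affineStep_cast hn] at h1
  split_ifs at h1 with h2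
  · rw [Equiv.swap_apply_eq_iff, Equiv.swap_apply_eq_iff, Equiv.swap_apply_left,
      Equiv.swap_apply_right] at h2
    exact h2
  · omega

theorem intCast_inj_of_lt {x y : ℤ} (h : (x : ZMod n) = y) (h1 : x - y < n) (h2 : y - x < n) :
    x = y := by
  rw [← sub_eq_zero, ← Int.cast_sub, ZMod.intCast_zmod_eq_zero_iff_dvd] at h
  have := Int.eq_zero_of_abs_lt_dvd h (abs_lt.2 ⟨by omega, h1⟩)
  omega

theorem rowLen_bot (a : ℕ) : (⊥ : YoungDiagram).rowLen a = 0 := by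
  by_contra h
  exact YoungDiagram.notMem_bot _ (YoungDiagram.mem_iff_lt_rowLen.2 (Nat.pos_of_ne_zero h))

theorem colLen_bot (b : ℕ) : (⊥ : YoungDiagram).colLen b = 0 := by
  by_contra h
  exact YoungDiagram.notMem_bot _ (YoungDiagram.mem_iff_lt_colLen.2 (Nat.pos_of_ne_zero h))

/-- With the gaps shifted by `n`, the columns occupy `1 - n, …, r - n` and the rows `r - n + 1, …,
0`: together `n` consecutive integers. -/
theorem residueInjOn_position_bot {r : ℕ} (hr : r ≤ n) : ResidueInjOn n r (position n ⊥) := by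
  rintro (a | b) hu (a' | b') hv h
  all_goals
    simp only [inl_mem_labels, inr_mem_labels] at hu hv
    simp only [position, rowLen_bot, colLen_bot] at h
    have h1 := intCast_inj_of_lt h (by omega) (by omega)
    first
    | omega
    | (congr 1; omega)

/-- The difference of positions minus `n` is the hook length, less than `n`, for a box of `lam`, and
lies strictly between `-n` and `0` otherwise. Each box thus contributes one. -/
theorem energy_position (hn : 2 ≤ n) {r : ℕ} {lam : YoungDiagram} (hrow : lam.rowLen 0 ≤ r)
    (hcol : lam.colLen 0 + r ≤ n) : energy n r (position n lam) = lam.card := by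
  have hN : (0 : ℤ) < n := by omega
  have hterm : ∀ u ∈ range (n - r) ×ˢ range r,
      (position n lam (.inl u.1) - position n lam (.inr u.2)) / (n : ℤ) =
        if u ∈ lam then 1 else 0 := by
    rintro ⟨a, b⟩ hu
    simp only [mem_product, mem_range] at hu
    have h1 := lam.rowLen_anti 0 a (Nat.zero_le _)
    have h2 := lam.colLen_anti 0 b (Nat.zero_le _)
    rw [Int.ediv_eq_iff_of_pos hN]
    simp only [position]
    split_ifs with h
    · have h3 := YoungDiagram.mem_iff_lt_rowLen.1 h
      have h4 := YoungDiagram.mem_iff_lt_colLen.1 h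
      omega
    · have h3 : ¬ b < lam.rowLen a := fun h3 => h (YoungDiagram.mem_iff_lt_rowLen.2 h3)
      have h4 : ¬ a < lam.colLen b := fun h4 => h (YoungDiagram.mem_iff_lt_colLen.2 h4)
      omega
  rw [energy, sum_congr rfl hterm, ← sum_filter, sum_const, nsmul_eq_mul, mul_one]
  congr 2
  ext ⟨a, b⟩
  simp only [mem_filter, mem_product, mem_range, YoungDiagram.mem_cells]
  refine ⟨fun h => h.2, fun h => ⟨?_, h⟩⟩
  have h1 := lam.rowLen_anti 0 a (Nat.zero_le _)
  have h2 := lam.colLen_anti 0 b (Nat.zero_le _)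
  have h3 := YoungDiagram.mem_iff_lt_rowLen.1 h
  have h4 := YoungDiagram.mem_iff_lt_colLen.1 h
  omega

theorem exists_isCorner_of_energy_lt (hn : 2 ≤ n) {lam : YoungDiagram} (hlam : IsKSmall n lam)
    (hP : ResidueInjOn n (lam.rowLen 0) (position n lam)) {i : ZMod n}
    (h : energy n (lam.rowLen 0) (fun u => affineStep n i (position n lam u)) <
      energy n (lam.rowLen 0) (position n lam)) :
    ∃ a b, IsCorner lam a b ∧ i = (b : ZMod n) - a := by
  have hlam' : lam.rowLen 0 + lam.colLen 0 ≤ n := hlam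
  obtain ⟨a, ha, b, hb, h1, h2⟩ := exists_of_energy_affineStep_lt hn hP h
  have ha' := lam.rowLen_anti 0 a (Nat.zero_le _)
  have hb' := lam.colLen_anti 0 b (Nat.zero_le _)
  have hb'' := YoungDiagram.mem_iff_lt_colLen.1 (YoungDiagram.mem_iff_lt_rowLen.2 hb)
  simp only [position] at h1 h2
  have h3 : ((lam.rowLen a - a : ℤ) : ZMod n) = ((b + 2 - lam.colLen b : ℤ) : ZMod n) := by
    rw [h1, ← h2]
    push_cast
    rw [ZMod.natCast_self]
    ring
  -- The congruence becomes the equality `λ_a + λ'_b = a + b + 2`. As `b < λ_a` iff `a < λ'_b`, both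
  -- lengths are then determined and `(a, b)` is a corner.
  have h4 := intCast_inj_of_lt h3 (by omega) (by omega)
  have hiff : b < lam.rowLen a ↔ a < lam.colLen b := by
    rw [← YoungDiagram.mem_iff_lt_rowLen, YoungDiagram.mem_iff_lt_colLen]
  have hcorner : IsCorner lam a b := ⟨by omega, by omega⟩
  refine ⟨a, b, hcorner, ?_⟩
  rw [← h2, hcorner.2]
  push_cast
  rw [ZMod.natCast_self]
  ring

theorem residueInjOn_affineAction (hn : 2 ≤ n) {r : ℕ} (hr : r ≤ n) (ω : List (ZMod n)) :
    ResidueInjOn n r fun u => affineAction hn ((affineSystem n).wordProd ω) (position n ⊥ u) := by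
  induction ω with
  | nil =>
    simp only [CoxeterSystem.wordProd_nil, map_one, Equiv.Perm.one_apply]
    exact residueInjOn_position_bot hr
  | cons i ω ih =>
    simp only [CoxeterSystem.wordProd_cons, affineAction_simple_mul]
    exact ih.affineStep hn i

theorem energy_affineAction_le (hn : 2 ≤ n) {r : ℕ} (hr : r ≤ n) (ω : List (ZMod n)) :
    energy n r (fun u => affineAction hn ((affineSystem n).wordProd ω) (position n ⊥ u)) ≤
      ω.length := by
  induction ω with
  | nil =>
    simp only [CoxeterSystem.wordProd_nil, map_one, Equiv.Perm.one_apply]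
    refine (energy_position hn (by rw [rowLen_bot]; omega) (by rw [colLen_bot]; omega)).le.trans ?_
    rfl
  | cons i ω ih =>
    simp only [CoxeterSystem.wordProd_cons, affineAction_simple_mul]
    refine (energy_affineStep_le hn (residueInjOn_affineAction hn hr ω) i).trans ?_
    rw [List.length_cons]
    push_cast
    exact add_le_add_left ih 1

/-! ### Reduced words of the affine Grassmannian element -/

theorem eq_bot_of_card_eq_zero {lam : YoungDiagram} (h : lam.card = 0) : lam = ⊥ :=
  YoungDiagram.ext (card_eq_zero.1 h)

theorem affineGrassmannian_bot (n : ℕ) : affineGrassmannian n ⊥ = 1 := by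
  rw [affineGrassmannian_eq n ⊥ le_rfl, colLen_bot]
  change ((affineSystem n).wordProd [])⁻¹ = 1
  rw [CoxeterSystem.wordProd_nil, inv_one]

/-- Adding the corner `(a, b)` raises the bead of row `a` by one and lowers the gap of column `b` by
one. Since residues are distinct, the simple reflection moves nothing else. -/
theorem affineAction_affineGrassmannian (hn : 2 ≤ n) {r : ℕ} {lam : YoungDiagram}
    (hrow : lam.rowLen 0 ≤ r) (hcol : lam.colLen 0 + r ≤ n) :
    ∀ u ∈ labels n r,
      affineAction hn (affineGrassmannian n lam) (position n ⊥ u) = position n lam u := by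
  induction hk : lam.card generalizing lam with
  | zero =>
    rw [eq_bot_of_card_eq_zero hk, affineGrassmannian_bot]
    simp
  | succ k ih =>
    obtain ⟨a, b, h⟩ := exists_isCorner (lam := lam) (by omega)
    have hb := lam.colLen_anti 0 b (Nat.zero_le _)
    have ha := lam.rowLen_anti 0 a (Nat.zero_le _)
    have h1 := h.1
    have h2 := h.2
    have hcard := card_removeCorner h
    have ih' := ih ((rowLen_removeCorner_le h 0).trans hrow)
      (by have := colLen_removeCorner_le h 0; omega) (by omega)
    have hinj : ResidueInjOn n r (position n (removeCorner lam a b h)) := by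
      intro u hu v hv huv
      refine residueInjOn_affineAction hn (by omega)
        (residueWord n (removeCorner lam a b h)) hu hv ?_
      change ((affineAction hn (affineGrassmannian n _) _ : ℤ) : ZMod n) =
        (affineAction hn (affineGrassmannian n _) _ : ℤ)
      rw [ih' u hu, ih' v hv]
      exact huv
    have hla : Sum.inl a ∈ labels n r := inl_mem_labels.2 (by omega)
    have hlb : Sum.inr b ∈ labels n r := inr_mem_labels.2 (by omega)
    have hpa : position n (removeCorner lam a b h) (.inl a) = b - a := by
      simp only [position, rowLen_removeCorner, if_true]
    have hpb : position n (removeCorner lam a b h) (.inr b) = b + 1 - a - n := by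
      simp only [position, colLen_removeCorner, Function.update_self]
    have hra : ((position n (removeCorner lam a b h) (.inl a) : ℤ) : ZMod n) = b - a := by
      rw [hpa]
      push_cast
      rfl
    have hrb : ((position n (removeCorner lam a b h) (.inr b) : ℤ) : ZMod n) = b - a + 1 := by
      rw [hpb]
      push_cast
      rw [ZMod.natCast_self]
      ring
    intro u hu
    rw [affineGrassmannian_removeCorner (by unfold IsKSmall; omega) h, affineAction_simple_mul,
      ih' u hu]
    rcases eq_or_ne u (.inl a) with rfl | hua
    · rw [affineStep_of_eq hra, hpa]
      simp only [position, h1]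
      push_cast
      ring
    rcases eq_or_ne u (.inr b) with rfl | hub
    · rw [affineStep_of_eq_add_one hn hrb, hpb]
      simp only [position, h2]
      push_cast
      ring
    rw [affineStep_of_ne (fun h0 => hua (hinj hu hla (h0.trans hra.symm)))
      (fun h0 => hub (hinj hu hlb (h0.trans hrb.symm)))]
    rcases u with a' | b'
    · have : a' ≠ a := fun h0 => hua (by rw [h0])
      simp only [position, rowLen_removeCorner, if_neg this]
    · have : b' ≠ b := fun h0 => hub (by rw [h0])
      simp only [position, colLen_removeCorner, Function.update_of_ne this]

/-- Every shortest word for the element attached to `lam` yields `det M / ξ`. -/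
theorem foldr_D_eq_detQuotOf (hn : 2 ≤ n) {lam : YoungDiagram} (hlam : IsKSmall n lam)
    (ω : List (ZMod n)) (hω : (affineSystem n).wordProd ω = affineGrassmannian n lam)
    (hlen : ω.length ≤ lam.card) : ω.foldr (D n) 1 = detQuotOf n lam := by
  induction ω generalizing lam with
  | nil =>
    have hlam' : lam.rowLen 0 + lam.colLen 0 ≤ n := hlam
    have h1 := energy_affineAction_le hn (r := lam.rowLen 0) (by omega) []
    rw [hω, energy_congr (affineAction_affineGrassmannian hn le_rfl (by omega)),
      energy_position hn le_rfl (by omega), List.length_nil] at h1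
    rw [eq_bot_of_card_eq_zero (lam := lam) (by omega), List.foldr_nil, detQuotOf, detQuot,
      rowLen_bot, colLen_bot, Matrix.det_fin_zero, xiOf, range_zero, prod_empty, inv_one,
      Units.val_one, mul_one]
  | cons i ω ih =>
    have hlam' : lam.rowLen 0 + lam.colLen 0 ≤ n := hlam
    have haction := affineAction_affineGrassmannian hn (lam := lam) le_rfl
      (by omega : lam.colLen 0 + lam.rowLen 0 ≤ n)
    have hω' : (affineSystem n).wordProd ω =
        (affineSystem n).simple i * affineGrassmannian n lam := by
      rw [← hω, CoxeterSystem.wordProd_cons, CoxeterSystem.simple_mul_simple_cancel_left]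
    have hinj : ResidueInjOn n (lam.rowLen 0) (position n lam) := by
      intro u hu v hv huv
      refine residueInjOn_affineAction hn (by omega) (residueWord n lam) hu hv ?_
      change ((affineAction hn (affineGrassmannian n _) _ : ℤ) : ZMod n) =
        (affineAction hn (affineGrassmannian n _) _ : ℤ)
      rw [haction u hu, haction v hv]
      exact huv
    -- After the letter `i` is undone, the remaining word has fewer than `|λ|` letters, which bounds
    -- the energy.
    have hlt : energy n (lam.rowLen 0) (fun u => affineStep n i (position n lam u)) <
        energy n (lam.rowLen 0) (position n lam) := by
      have h1 := energy_affineAction_le hn (r := lam.rowLen 0) (by omega) ω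
      rw [energy_congr (Q := fun u => affineStep n i (position n lam u)) fun u hu => by
        rw [hω', affineAction_simple_mul, haction u hu]] at h1
      rw [energy_position hn le_rfl (by omega)]
      rw [List.length_cons] at hlen
      omega
    obtain ⟨a, b, h, rfl⟩ := exists_isCorner_of_energy_lt hn hlam hinj hlt
    have hcard := card_removeCorner h
    rw [List.length_cons] at hlen
    rw [List.foldr_cons, ih (hlam.removeCorner h) ?_ (by omega), D_detQuotOf hlam h]
    rw [hω', affineGrassmannian_removeCorner hlam h,
      CoxeterSystem.simple_mul_simple_cancel_left]

theorem length_affineGrassmannian_le {lam : YoungDiagram} (hlam : IsKSmall n lam) :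
    (affineSystem n).length (affineGrassmannian n lam) ≤ lam.card := by
  induction hk : lam.card generalizing lam with
  | zero => rw [eq_bot_of_card_eq_zero hk, affineGrassmannian_bot, CoxeterSystem.length_one]
  | succ k ih =>
    obtain ⟨a, b, h⟩ := exists_isCorner (lam := lam) (by omega)
    have hcard := card_removeCorner h
    rw [affineGrassmannian_removeCorner hlam h]
    refine (CoxeterSystem.length_mul_le _ _ _).trans ?_
    rw [CoxeterSystem.length_simple]
    have := ih (hlam.removeCorner h) (by omega)
    omega

end

end KDoubleSchur

end

theorem mainTheorem4 (n : ℕ) (hn : 2 ≤ n) (lam : YoungDiagram)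
    (hlam : KDoubleSchur.IsKSmall n lam) :
    KDoubleSchur.gTilde n lam =
      (KDoubleSchur.M n lam).det * (((KDoubleSchur.xi n lam)⁻¹ : (KDoubleSchur.PS n)ˣ) :
        KDoubleSchur.PS n) := by
  -- The chosen word is reduced, so its length is that of `x_λ`, hence at most `|λ|`; nothing else
  -- about the choice matters.
  obtain ⟨hred, hprod⟩ := ((KDoubleSchur.affineSystem n).exists_isReduced
    (KDoubleSchur.affineGrassmannian n lam)).choose_spec
  rw [KDoubleSchur.M_eq_coordMatrix, KDoubleSchur.xi_eq_xiOf]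
  refine KDoubleSchur.foldr_D_eq_detQuotOf hn hlam _ hprod.symm ?_
  refine hred.eq.symm.le.trans ?_
  rw [← hprod]
  exact KDoubleSchur.length_affineGrassmannian_le hlam
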